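/- Let $p$ be a prime and $\mathbb K$ a field of characteristic zero. For finite groups $H,G$, a finite $(H,G)$-biset is $p$-bifree if the left and the right stabilizers of its points have order prime to $p$; let $B^\Delta(H,G)$ be the Grothendieck group of $p$-bifree $(H,G)$-bisets. Let $\mathbb K\mathcal C^\Delta$ be the category whose objects are the finite groups, with $\mathrm{Hom}(G,H)=\mathbb K\otimes_{\mathbb Z}B^\Delta(H,G)$ and composition induced by the product $X\times_H Y$ of bisets. Let $\mathbb KB:\mathbb K\mathcal C^\Delta\to\mathbb K\text{-Mod}$ be the Burnside functor, sending $G$ to $\mathbb KB(G)=\mathbb K\otimes_{\mathbb Z}B(G)$, where $B(G)$ is the Burnside ring of finite $G$-sets, and a biset $X$ to $U\mapsto X\times_G U$. For a finite group $G$, let $e^G_G$ be the primitive idempotent of $\mathbb KB(G)$ on which the linear map $\mathbb KB(G)\to\mathbb K$, $[U]\mapsto |U^G|$, takes the value $1$, and let $\mathbf e^\Delta_G$ be the subfunctor of $\mathbb KB$ generated by $e^G_G$. For a normal subgroup $N$ of $G$ put $$m_{G,N}=\frac1{|G|}\sum_{X\le G,\ XN=G}|X|\,\mu(X,G),$$ where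 $\mu$ is the Möbius function of the lattice of subgroups of $G$. A finite group $G$ is a $B^\Delta_p$-group if $m_{G,N}=0$ for every non-trivial normal subgroup $N$ of $G$ of order prime to $p$. Let $[B^\Delta_p\text{-gr}]$ be a set of representatives of the isomorphism classes of $B^\Delta_p$-groups. Write $G\gg H$ if $H\cong G/N$ for some normal subgroup $N$ of $G$ of order prime to $p$. A subset $A$ of $[B^\Delta_p\text{-gr}]$ is closed if $H\in A$, $G\in[B^\Delta_p\text{-gr}]$ and $G\gg H$ imply $G\in A$. Let $\mathcal S$ be the set of subfunctors of $\mathbb KB$ and $\mathcal T$ the set of closed subsets of $[B^\Delta_p\text{-gr}]$, both ordered by inclusion. Then $$\Theta:\mathcal S\to\mathcal T,\qquad F\mapsto\{H\in[B^\Delta_p\text{-gr}] : \mathbf e^\Delta_H\subseteq F\}$$ is a well-defined isomorphism of posets, and its inverse is $$\Psi:\mathcal T\to\mathcal S,\qquad A\mapsto\sum_{H\in A}\mathbf e^\Delta_H .$$ -/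

import Mathlib

open CategoryTheory MulOpposite TensorProduct
open Algebra (GrothendieckAddGroup)

universe u v w

noncomputable section

namespace PBifree

/-! ### Grothendieck groups and extension of scalars -/

section Grothendieck

variable {M N P A : Type*} [AddCommMonoid M] [AddCommMonoid N] [AddCommMonoid P] [AddCommGroup A]

/-- The class in the Grothendieck group of an element of a commutative monoid. -/
def cl : M →+ GrothendieckAddGroup M := GrothendieckAddGroup.of

theorem lift_cl (f : M →+ A) (m : M) : GrothendieckAddGroup.lift f (cl m) = f m :=
  DFunLike.congr_fun (GrothendieckAddGroup.lift.symm_apply_apply f) m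

theorem gr_hom_ext {f g : GrothendieckAddGroup M →+ A} (h : ∀ m, f (cl m) = g (cl m)) : f = g :=
  GrothendieckAddGroup.lift.symm.injective (AddMonoidHom.ext h)

/-- A biadditive map of commutative monoids induces one of Grothendieck groups. -/
def grLift₂ (f : M →+ N →+ P) :
    GrothendieckAddGroup M →+ GrothendieckAddGroup N →+ GrothendieckAddGroup P :=
  GrothendieckAddGroup.lift
    { toFun := fun m => GrothendieckAddGroup.lift (cl.comp (f m))
      map_zero' := gr_hom_ext fun n => by rw [lift_cl]; simp
      map_add' := fun a b => gr_hom_ext fun n => by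
        rw [AddMonoidHom.add_apply, lift_cl, lift_cl, lift_cl]; simp }

theorem grLift₂_cl (f : M →+ N →+ P) (m : M) (n : N) :
    grLift₂ f (cl m) (cl n) = cl (f m n) := by
  rw [grLift₂, lift_cl]
  exact lift_cl _ _

@[elab_as_elim]
theorem gr_ind {Q : GrothendieckAddGroup M → Prop} (x : GrothendieckAddGroup M)
    (h : ∀ a b : M, Q (cl a - cl b)) : Q x := by
  induction x using AddLocalization.ind with
  | H y =>
    have := h y.1 y.2
    rwa [show cl y.1 - cl (y.2 : M) = AddLocalization.mk y.1 y.2 from ?_] at this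
    have key (m : M) : cl m = AddLocalization.mk m 0 :=
      (AddLocalization.mk_zero_eq_addMonoidOf_mk (S := ⊤) m).symm
    rw [key, key, GrothendieckAddGroup.mk_sub_mk]
    simp

/-- The Grothendieck ring of a commutative semiring. -/
abbrev grRing (S : Type*) [CommSemiring S] : CommRing (GrothendieckAddGroup S) where
  __ : AddCommGroup (GrothendieckAddGroup S) := inferInstance
  mul x y := grLift₂ AddMonoidHom.mul x y
  one := cl 1
  left_distrib x y z := map_add (grLift₂ AddMonoidHom.mul x) y z
  right_distrib x y z := by
    change grLift₂ AddMonoidHom.mul (x + y) z = _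
    rw [map_add]; rfl
  zero_mul x := by
    change grLift₂ AddMonoidHom.mul 0 x = 0
    rw [map_zero]; rfl
  mul_zero x := map_zero (grLift₂ AddMonoidHom.mul x)
  one_mul x := by
    change grLift₂ AddMonoidHom.mul (cl 1) x = x
    induction x using gr_ind with
    | h a b => simp [map_sub, grLift₂_cl]
  mul_one x := by
    change grLift₂ AddMonoidHom.mul x (cl 1) = x
    induction x using gr_ind with
    | h a b => simp [map_sub, grLift₂_cl]
  mul_comm x y := by
    change grLift₂ AddMonoidHom.mul x y = grLift₂ AddMonoidHom.mul y x
    induction x using gr_ind with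
    | h a b =>
    induction y using gr_ind with
    | h c d =>
    simp only [map_sub, grLift₂_cl, AddMonoidHom.sub_apply, AddMonoidHom.mul_apply,
      mul_comm c, mul_comm d]
    abel
  mul_assoc x y z := by
    change grLift₂ AddMonoidHom.mul (grLift₂ AddMonoidHom.mul x y) z =
      grLift₂ AddMonoidHom.mul x (grLift₂ AddMonoidHom.mul y z)
    induction x using gr_ind with
    | h a b =>
    induction y using gr_ind with
    | h c d =>
    induction z using gr_ind with
    | h e f =>
    simp only [map_sub, grLift₂_cl, AddMonoidHom.sub_apply, AddMonoidHom.mul_apply, mul_assoc]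

variable (R : Type v) [CommRing R]

/-- A biadditive map of commutative monoids induces an `R`-bilinear map between the Grothendieck
groups with scalars extended to `R`. -/
def scalarLift₂ (f : M →+ N →+ P) :
    R ⊗[ℤ] GrothendieckAddGroup M →ₗ[R]
      R ⊗[ℤ] GrothendieckAddGroup N →ₗ[R] R ⊗[ℤ] GrothendieckAddGroup P :=
  LinearMap.liftBaseChange R
    (AddMonoidHom.toIntLinearMap
      { toFun := fun x => LinearMap.baseChange R (grLift₂ f x).toIntLinearMap
        map_zero' := by ext; simp
        map_add' := fun x y => by ext; simp [TensorProduct.tmul_add] })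

theorem scalarLift₂_tmul (f : M →+ N →+ P) (r s : R) (m : M) (n : N) :
    scalarLift₂ R f (r ⊗ₜ cl m) (s ⊗ₜ cl n) = (r * s) ⊗ₜ cl (f m n) := by
  simp [scalarLift₂, grLift₂_cl, TensorProduct.smul_tmul']

variable {R} in
@[elab_as_elim]
theorem scalar_ind {Q : R ⊗[ℤ] GrothendieckAddGroup M → Prop}
    (x : R ⊗[ℤ] GrothendieckAddGroup M) (h : ∀ (r : R) (m : M), Q (r ⊗ₜ cl m))
    (hadd : ∀ x y, Q x → Q y → Q (x + y)) : Q x := by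
  induction x using TensorProduct.induction_on with
  | zero => simpa using h 0 0
  | add x y hx hy => exact hadd x y hx hy
  | tmul r y =>
    induction y using gr_ind with
    | h a b =>
    have : r ⊗ₜ[ℤ] (cl a - cl b) = r ⊗ₜ cl a + (-r) ⊗ₜ cl b := by
      rw [TensorProduct.tmul_sub, TensorProduct.neg_tmul, sub_eq_add_neg]
    rw [this]
    exact hadd _ _ (h _ _) (h _ _)

end Grothendieck

/-! ### The product `X ×_G U` of a right `G`-set and a left `G`-set -/

section Tens

variable (G : Type*) (X U : Type*) [Group G] [MulAction Gᵐᵒᵖ X] [MulAction G U]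

/-- The relation identifying `(x g, u)` with `(x, g u)`; a right action of `G` on `X` is an action
of `Gᵐᵒᵖ`. -/
def tensSetoid : Setoid (X × U) where
  r a b := ∃ g : G, a.1 = op g • b.1 ∧ b.2 = g • a.2
  iseqv :=
    { refl := fun a => ⟨1, by simp, by simp⟩
      symm := fun {a b} ⟨g, h₁, h₂⟩ => ⟨g⁻¹, by simp [h₁], by simp [h₂]⟩
      trans := fun {a b c} ⟨g, h₁, h₂⟩ ⟨k, h₃, h₄⟩ =>
        ⟨k * g, by rw [h₁, h₃, smul_smul, op_mul], by rw [h₄, h₂, smul_smul]⟩ }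

/-- The product `X ×_G U`. -/
def Tens : Type _ := Quotient (tensSetoid G X U)

variable {X U}

/-- The class of `(x, u)` in `X ×_G U`. -/
def Tens.mk (x : X) (u : U) : Tens G X U := Quotient.mk (tensSetoid G X U) (x, u)

variable {G}

theorem Tens.mk_smul (g : G) (x : X) (u : U) :
    Tens.mk G (op g • x) u = Tens.mk G x (g • u) :=
  Quotient.sound ⟨g, rfl, rfl⟩

theorem Tens.exact {x x' : X} {u u' : U} (h : Tens.mk G x u = Tens.mk G x' u') :
    ∃ g : G, x = op g • x' ∧ u' = g • u :=
  Quotient.exact (s := tensSetoid G X U) h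

@[elab_as_elim]
theorem Tens.ind {Q : Tens G X U → Prop} (h : ∀ x u, Q (Tens.mk G x u)) (t : Tens G X U) : Q t :=
  Quotient.inductionOn t fun a => h a.1 a.2

/-- Maps out of `X ×_G U`. -/
def Tens.lift {A : Type*} (f : X → U → A) (h : ∀ (g : G) x u, f (op g • x) u = f x (g • u)) :
    Tens G X U → A :=
  Quotient.lift (fun a => f a.1 a.2) (by
    rintro ⟨a, b⟩ ⟨c, d⟩ ⟨g, h₁, h₂⟩
    dsimp only at h₁ h₂ ⊢
    rw [h₁, h₂, h])

@[simp]
theorem Tens.lift_mk {A : Type*} (f : X → U → A) (h : ∀ (g : G) x u, f (op g • x) u = f x (g • u))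
    (x : X) (u : U) : Tens.lift f h (Tens.mk G x u) = f x u := rfl

instance [Finite X] [Finite U] : Finite (Tens G X U) := Quotient.finite _

/-- A left action of `H` on `X` commuting with the right action of `G` gives a left action of `H`
on `X ×_G U`. -/
instance Tens.leftAction {H : Type*} [Group H] [MulAction H X] [SMulCommClass H Gᵐᵒᵖ X] :
    MulAction H (Tens G X U) where
  smul h := Tens.lift (fun x u => Tens.mk G (h • x) u) fun g x u => by
    rw [smul_comm, Tens.mk_smul]
  one_smul := Tens.ind fun x u => by
    change Tens.mk G ((1 : H) • x) u = _
    rw [one_smul]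
  mul_smul a b := Tens.ind fun x u => by
    change Tens.mk G ((a * b) • x) u = Tens.mk G (a • b • x) u
    rw [mul_smul]

/-- A right action of `K` on `U` commuting with the left action of `G` gives a right action of `K`
on `X ×_G U`. -/
instance Tens.rightAction {K : Type*} [Group K] [MulAction Kᵐᵒᵖ U] [SMulCommClass G Kᵐᵒᵖ U] :
    MulAction Kᵐᵒᵖ (Tens G X U) where
  smul k := Tens.lift (fun x u => Tens.mk G x (k • u)) fun g x u => by
    rw [Tens.mk_smul, smul_comm]
  one_smul := Tens.ind fun x u => by
    change Tens.mk G x ((1 : Kᵐᵒᵖ) • u) = _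
    rw [one_smul]
  mul_smul a b := Tens.ind fun x u => by
    change Tens.mk G x ((a * b) • u) = Tens.mk G x (a • b • u)
    rw [mul_smul]

theorem Tens.left_smul {H : Type*} [Group H] [MulAction H X] [SMulCommClass H Gᵐᵒᵖ X]
    (h : H) (x : X) (u : U) : h • Tens.mk G x u = Tens.mk G (h • x) u := rfl

theorem Tens.right_smul {K : Type*} [Group K] [MulAction Kᵐᵒᵖ U] [SMulCommClass G Kᵐᵒᵖ U]
    (k : K) (x : X) (u : U) : op k • Tens.mk G x u = Tens.mk G x (op k • u) := rfl

instance {H K : Type*} [Group H] [MulAction H X] [SMulCommClass H Gᵐᵒᵖ X]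
    [Group K] [MulAction Kᵐᵒᵖ U] [SMulCommClass G Kᵐᵒᵖ U] :
    SMulCommClass H Kᵐᵒᵖ (Tens G X U) where
  smul_comm _ _ := Tens.ind fun _ _ => rfl

variable (G) in
/-- Functoriality of `X ×_G U` with respect to isomorphisms. -/
def Tens.congr {X' U' : Type*} [MulAction Gᵐᵒᵖ X'] [MulAction G U'] (e : X ≃ X') (f : U ≃ U')
    (he : ∀ (g : G) x, e (op g • x) = op g • e x) (hf : ∀ (g : G) u, f (g • u) = g • f u) :
    Tens G X U ≃ Tens G X' U' where
  toFun := Tens.lift (fun x u => Tens.mk G (e x) (f u)) fun g x u => by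
    rw [he, hf, Tens.mk_smul]
  invFun := Tens.lift (fun x u => Tens.mk G (e.symm x) (f.symm u)) fun g x u => by
    have h₁ : e.symm (op g • x) = op g • e.symm x := by
      rw [Equiv.symm_apply_eq, he, Equiv.apply_symm_apply]
    have h₂ : f.symm (g • u) = g • f.symm u := by
      rw [Equiv.symm_apply_eq, hf, Equiv.apply_symm_apply]
    rw [h₁, h₂, Tens.mk_smul]
  left_inv := Tens.ind fun x u => by simp
  right_inv := Tens.ind fun x u => by simp

variable (G X U) in
/-- `(X ⊔ Y) ×_G U = (X ×_G U) ⊔ (Y ×_G U)`. -/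
def Tens.sumLeft (Y : Type*) [MulAction Gᵐᵒᵖ Y] :
    Tens G (X ⊕ Y) U ≃ Tens G X U ⊕ Tens G Y U where
  toFun := Tens.lift (fun s u => s.elim (fun x => .inl (Tens.mk G x u))
      fun y => .inr (Tens.mk G y u)) fun g s u => by
    rcases s with x | y
    · exact congrArg Sum.inl (Tens.mk_smul g x u)
    · exact congrArg Sum.inr (Tens.mk_smul g y u)
  invFun := Sum.elim
    (Tens.lift (fun x u => Tens.mk G (.inl x) u) fun g x u => Tens.mk_smul g (Sum.inl x : X ⊕ Y) u)
    (Tens.lift (fun y u => Tens.mk G (.inr y) u) fun g y u => Tens.mk_smul g (Sum.inr y : X ⊕ Y) u)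
  left_inv := Tens.ind fun s u => by rcases s with x | y <;> rfl
  right_inv := by
    rintro (t | t)
    · induction t using Tens.ind with
      | h x u => rfl
    · induction t using Tens.ind with
      | h x u => rfl

variable (G X U) in
/-- `X ×_G (U ⊔ V) = (X ×_G U) ⊔ (X ×_G V)`. -/
def Tens.sumRight (V : Type*) [MulAction G V] :
    Tens G X (U ⊕ V) ≃ Tens G X U ⊕ Tens G X V where
  toFun := Tens.lift (fun x s => s.elim (fun u => .inl (Tens.mk G x u))
      fun v => .inr (Tens.mk G x v)) fun g x s => by
    rcases s with u | v
    · exact congrArg Sum.inl (Tens.mk_smul g x u)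
    · exact congrArg Sum.inr (Tens.mk_smul g x v)
  invFun := Sum.elim
    (Tens.lift (fun x u => Tens.mk G x (.inl u)) fun g x u => Tens.mk_smul g x (Sum.inl u : U ⊕ V))
    (Tens.lift (fun x v => Tens.mk G x (.inr v)) fun g x v => Tens.mk_smul g x (Sum.inr v : U ⊕ V))
  left_inv := Tens.ind fun x s => by rcases s with u | v <;> rfl
  right_inv := by
    rintro (t | t)
    · induction t using Tens.ind with
      | h x u => rfl
    · induction t using Tens.ind with
      | h x u => rfl

variable (G U) in
/-- `G ×_G U = U`. -/
def Tens.idLeft : Tens G G U ≃ U where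
  toFun := Tens.lift (fun g u => g • u) fun g x u => by
    rw [op_smul_eq_mul, mul_smul]
  invFun u := Tens.mk G 1 u
  left_inv := Tens.ind fun g u => by
    change Tens.mk G 1 (g • u) = _
    rw [← Tens.mk_smul, op_smul_eq_mul, one_mul]
  right_inv u := one_smul G u

variable (G X) in
/-- `X ×_G G = X`. -/
def Tens.idRight : Tens G X G ≃ X where
  toFun := Tens.lift (fun x g => op g • x) fun g x u => by
    rw [smul_smul, smul_eq_mul, op_mul]
  invFun x := Tens.mk G x 1
  left_inv := Tens.ind fun x g => by
    change Tens.mk G (op g • x) 1 = _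
    rw [Tens.mk_smul, smul_eq_mul, mul_one]
  right_inv x := by
    change op (1 : G) • x = x
    rw [op_one, one_smul]

/-- `(X ×_H Y) ×_G Z = X ×_H (Y ×_G Z)`. -/
def Tens.assoc (H G : Type*) (X Y Z : Type*) [Group H] [Group G] [MulAction Hᵐᵒᵖ X]
    [MulAction H Y] [MulAction Gᵐᵒᵖ Y] [SMulCommClass H Gᵐᵒᵖ Y] [MulAction G Z] :
    Tens G (Tens H X Y) Z ≃ Tens H X (Tens G Y Z) where
  toFun := Tens.lift (fun t z => Tens.lift (fun x y => Tens.mk H x (Tens.mk G y z))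
      (fun h x y => Tens.mk_smul h x (Tens.mk G y z)) t)
    fun g t z => by
      induction t using Tens.ind with
      | h x y => exact congrArg (Tens.mk H x) (Tens.mk_smul g y z)
  invFun := Tens.lift (fun x t => Tens.lift (fun y z => Tens.mk G (Tens.mk H x y) z)
      (fun g y z => Tens.mk_smul g (Tens.mk H x y) z) t)
    fun h x t => by
      induction t using Tens.ind with
      | h y z => exact congrArg (fun s => Tens.mk G s z) (Tens.mk_smul h x y)
  left_inv t := by
    induction t using Tens.ind with
    | h s z =>
    induction s using Tens.ind with
    | h x y => rfl
  right_inv t := by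
    induction t using Tens.ind with
    | h x s =>
    induction s using Tens.ind with
    | h y z => rfl

end Tens

/-! ### Finite `G`-sets and the Burnside ring -/

section GSet

variable (G : Type u) [Group G]

/-- A finite left `G`-set. -/
structure GSet : Type (u + 1) where
  /-- the underlying set -/
  carrier : Type u
  [fin : Finite carrier]
  [act : MulAction G carrier]

attribute [instance] GSet.fin GSet.act

instance : CoeSort (GSet G) (Type u) := ⟨GSet.carrier⟩

/-- Isomorphism of `G`-sets. -/
instance gsetSetoid : Setoid (GSet G) where
  r X Y := ∃ e : X ≃ Y, ∀ (g : G) (x : X), e (g • x) = g • e x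
  iseqv :=
    { refl := fun _ => ⟨Equiv.refl _, fun _ _ => rfl⟩
      symm := fun ⟨e, h⟩ => ⟨e.symm, fun g x => by
        rw [Equiv.symm_apply_eq, h, Equiv.apply_symm_apply]⟩
      trans := fun ⟨e, h⟩ ⟨f, k⟩ => ⟨e.trans f, fun g x => by simp [h, k]⟩ }

/-- The isomorphism classes of finite `G`-sets. -/
def GSetClass : Type (u + 1) := Quotient (gsetSetoid G)

variable {G}

/-- The isomorphism class of a finite `G`-set. -/
def GSet.cls (X : GSet G) : GSetClass G := Quotient.mk _ X

theorem GSet.cls_eq {X Y : GSet G} (e : X ≃ Y) (h : ∀ (g : G) (x : X), e (g • x) = g • e x) :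
    X.cls = Y.cls := Quotient.sound ⟨e, h⟩

@[elab_as_elim]
theorem GSetClass.ind {Q : GSetClass G → Prop} (c : GSetClass G) (h : ∀ X : GSet G, Q X.cls) :
    Q c := Quotient.inductionOn c h

/-- The action of a group on the empty set. -/
instance emptyAction (A : Type*) [Group A] : MulAction A PEmpty.{u + 1} where
  smul _ x := x
  one_smul _ := rfl
  mul_smul _ _ _ := rfl

/-- The empty `G`-set. -/
def GSet.empty : GSet G where
  carrier := PEmpty

/-- The one-point `G`-set. -/
def GSet.point : GSet G where
  carrier := PUnit
  act := { smul := fun _ x => x, one_smul := fun _ => rfl, mul_smul := fun _ _ _ => rfl }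

/-- The disjoint union of two `G`-sets. -/
def GSet.sum (X Y : GSet G) : GSet G where
  carrier := X ⊕ Y

/-- The product of two `G`-sets, with the diagonal action. -/
def GSet.prod (X Y : GSet G) : GSet G where
  carrier := X × Y

instance : Zero (GSetClass G) := ⟨GSet.empty.cls⟩

instance : One (GSetClass G) := ⟨GSet.point.cls⟩

instance : Add (GSetClass G) where
  add := Quotient.map₂ GSet.sum (by
    rintro X X' ⟨e, h⟩ Y Y' ⟨f, k⟩
    exact ⟨Equiv.sumCongr e f, by
      rintro g (x | y)
      · exact congrArg Sum.inl (h g x)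
      · exact congrArg Sum.inr (k g y)⟩)

instance : Mul (GSetClass G) where
  mul := Quotient.map₂ GSet.prod (by
    rintro X X' ⟨e, h⟩ Y Y' ⟨f, k⟩
    exact ⟨Equiv.prodCongr e f, by
      rintro g ⟨x, y⟩
      exact Prod.ext (h g x) (k g y)⟩)

/-- Disjoint union and direct product make the isomorphism classes of finite `G`-sets a
commutative semiring. -/
instance : CommSemiring (GSetClass G) where
  nsmul := nsmulRec
  add_assoc a b c := by
    induction a using GSetClass.ind with | h X =>
    induction b using GSetClass.ind with | h Y =>
    induction c using GSetClass.ind with | h Z =>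
    exact GSet.cls_eq (X := (X.sum Y).sum Z) (Y := X.sum (Y.sum Z)) (Equiv.sumAssoc X Y Z)
      (by rintro g ((x | y) | z) <;> rfl)
  zero_add a := by
    induction a using GSetClass.ind with | h X =>
    exact GSet.cls_eq (X := GSet.empty.sum X) (Y := X) (Equiv.emptySum PEmpty X)
      (by rintro g (⟨⟨⟩⟩ | z); rfl)
  add_zero a := by
    induction a using GSetClass.ind with | h X =>
    exact GSet.cls_eq (X := X.sum GSet.empty) (Y := X) (Equiv.sumEmpty X PEmpty)
      (by rintro g (z | ⟨⟨⟩⟩); rfl)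
  add_comm a b := by
    induction a using GSetClass.ind with | h X =>
    induction b using GSetClass.ind with | h Y =>
    exact GSet.cls_eq (X := X.sum Y) (Y := Y.sum X) (Equiv.sumComm X Y)
      (by rintro g (x | y) <;> rfl)
  mul_assoc a b c := by
    induction a using GSetClass.ind with | h X =>
    induction b using GSetClass.ind with | h Y =>
    induction c using GSetClass.ind with | h Z =>
    exact GSet.cls_eq (X := (X.prod Y).prod Z) (Y := X.prod (Y.prod Z)) (Equiv.prodAssoc X Y Z)
      (fun g x => rfl)
  one_mul a := by
    induction a using GSetClass.ind with | h X =>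
    exact GSet.cls_eq (X := GSet.point.prod X) (Y := X) (Equiv.punitProd X) (fun g x => rfl)
  mul_one a := by
    induction a using GSetClass.ind with | h X =>
    exact GSet.cls_eq (X := X.prod GSet.point) (Y := X) (Equiv.prodPUnit X) (fun g x => rfl)
  mul_comm a b := by
    induction a using GSetClass.ind with | h X =>
    induction b using GSetClass.ind with | h Y =>
    exact GSet.cls_eq (X := X.prod Y) (Y := Y.prod X) (Equiv.prodComm X Y) (fun g x => rfl)
  zero_mul a := by
    induction a using GSetClass.ind with | h X =>
    exact GSet.cls_eq (X := GSet.empty.prod X) (Y := GSet.empty) (Equiv.pemptyProd X)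
      (by rintro g ⟨⟨⟩, x⟩)
  mul_zero a := by
    induction a using GSetClass.ind with | h X =>
    exact GSet.cls_eq (X := X.prod GSet.empty) (Y := GSet.empty) (Equiv.prodPEmpty X)
      (by rintro g ⟨x, ⟨⟩⟩)
  left_distrib a b c := by
    induction a using GSetClass.ind with | h X =>
    induction b using GSetClass.ind with | h Y =>
    induction c using GSetClass.ind with | h Z =>
    exact GSet.cls_eq (X := X.prod (Y.sum Z)) (Y := (X.prod Y).sum (X.prod Z))
      (Equiv.prodSumDistrib X Y Z) (by rintro g ⟨x, (y | z)⟩ <;> rfl)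
  right_distrib a b c := by
    induction a using GSetClass.ind with | h X =>
    induction b using GSetClass.ind with | h Y =>
    induction c using GSetClass.ind with | h Z =>
    exact GSet.cls_eq (X := (X.sum Y).prod Z) (Y := (X.prod Z).sum (Y.prod Z))
      (Equiv.sumProdDistrib X Y Z) (by rintro g ⟨(x | y), z⟩ <;> rfl)

variable (G) in
/-- The Burnside ring `B(G)`: the Grothendieck ring of finite `G`-sets. -/
abbrev Burnside : Type (u + 1) := GrothendieckAddGroup (GSetClass G)

instance : CommRing (Burnside G) := grRing (GSetClass G)

variable (R : Type v) [CommRing R]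

variable (G) in
/-- The algebra `RB(G) = R ⊗ B(G)`. -/
abbrev RBurnside : Type (max v (u + 1)) := R ⊗[ℤ] Burnside G

/-- The number of fixed points of a subgroup on a finite `G`-set, as a function on isomorphism
classes. -/
def fixCount (L : Subgroup G) : GSetClass G →+ ℕ where
  toFun := Quotient.lift (fun X : GSet G => Nat.card (MulAction.fixedPoints L X)) (by
    rintro X Y ⟨e, h⟩
    refine Nat.card_congr (e.subtypeEquiv fun x => forall_congr' fun l => ?_)
    change (l : G) • x = x ↔ (l : G) • e x = e x
    rw [← h, e.apply_eq_iff_eq])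
  map_zero' := by
    change Nat.card (MulAction.fixedPoints L (PEmpty : Type u)) = 0
    exact Nat.card_of_isEmpty
  map_add' a b := by
    induction a using GSetClass.ind with | h X =>
    induction b using GSetClass.ind with | h Y =>
    change Nat.card (MulAction.fixedPoints L (X ⊕ Y)) =
      Nat.card (MulAction.fixedPoints L X) + Nat.card (MulAction.fixedPoints L Y)
    rw [← Nat.card_sum]
    refine Nat.card_congr
      { toFun := fun s => match s with
          | ⟨.inl x, h⟩ => .inl ⟨x, fun l => Sum.inl_injective (h l)⟩
          | ⟨.inr y, h⟩ => .inr ⟨y, fun l => Sum.inr_injective (h l)⟩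
        invFun := fun s => match s with
          | .inl x => ⟨.inl x.1, fun l => congrArg Sum.inl (x.2 l)⟩
          | .inr y => ⟨.inr y.1, fun l => congrArg Sum.inr (y.2 l)⟩
        left_inv := ?_
        right_inv := ?_ }
    · rintro ⟨x | y, h⟩ <;> rfl
    · rintro (x | y) <;> rfl

/-- The mark at `L`: the `R`-linear map `RB(G) → R` that sends the class of a `G`-set `X` to
`|X^L|`. -/
def mark (L : Subgroup G) : RBurnside G R →ₗ[R] R :=
  LinearMap.liftBaseChange R (AddMonoidHom.toIntLinearMap
    (GrothendieckAddGroup.lift ((Nat.castAddMonoidHom R).comp (fixCount L))))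

/-- A primitive idempotent of a commutative ring: a non-zero idempotent that is not a sum of two
non-zero orthogonal idempotents. -/
def IsPrimitiveIdempotent {A : Type*} [CommRing A] (e : A) : Prop :=
  IsIdempotentElem e ∧ e ≠ 0 ∧ ∀ a b : A, IsIdempotentElem a → IsIdempotentElem b →
    a * b = 0 → a + b = e → a = 0 ∨ b = 0

/-- The primitive idempotent `e^G_L` of `RB(G)` indexed by the subgroup `L`: the one whose mark at
`L` is `1`. (Over a field of characteristic zero it exists and is unique.) -/
def burnsideIdempotent (L : Subgroup G) : RBurnside G R :=
  Classical.epsilon fun e => IsPrimitiveIdempotent e ∧ mark R L e = 1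

end GSet

/-! ### Bisets -/

section Biset

/-- A finite `(H, G)`-biset: a finite set with commuting left `H`-action and right `G`-action. -/
structure Biset (H G : Type u) [Group H] [Group G] : Type (u + 1) where
  /-- the underlying set -/
  carrier : Type u
  [fin : Finite carrier]
  [left : MulAction H carrier]
  [right : MulAction Gᵐᵒᵖ carrier]
  [comm : SMulCommClass H Gᵐᵒᵖ carrier]

attribute [instance] Biset.fin Biset.left Biset.right Biset.comm

variable {K H G : Type u} [Group K] [Group H] [Group G]

instance : CoeSort (Biset H G) (Type u) := ⟨Biset.carrier⟩

/-- A biset is `p`-bifree if the left and the right stabilizers of its points are `p'`-groups. -/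
def Biset.IsBifree (p : ℕ) (X : Biset H G) : Prop :=
  ∀ x : X, (Nat.card (MulAction.stabilizer H x)).Coprime p ∧
    (Nat.card (MulAction.stabilizer Gᵐᵒᵖ x)).Coprime p

/-- The empty biset. -/
def Biset.empty : Biset H G where
  carrier := PEmpty
  comm := { smul_comm := fun _ _ _ => rfl }

/-- The disjoint union of two bisets. -/
def Biset.sum (X Y : Biset H G) : Biset H G where
  carrier := X ⊕ Y

/-- The product `X ×_H Y` of bisets. -/
def Biset.comp (X : Biset K H) (Y : Biset H G) : Biset K G where
  carrier := Tens H X Y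

variable (G) in
/-- The identity biset `G`. -/
def Biset.id [Finite G] : Biset G G where
  carrier := G

/-- The product `X ×_G U` of a biset and a `G`-set. -/
def Biset.act (X : Biset H G) (U : GSet G) : GSet H where
  carrier := Tens G X U

variable (p : ℕ)

theorem Biset.isBifree_empty : (Biset.empty : Biset H G).IsBifree p := fun x => x.elim

theorem Biset.IsBifree.sum {X Y : Biset H G} (hX : X.IsBifree p) (hY : Y.IsBifree p) :
    (X.sum Y).IsBifree p := by
  rintro (x | y)
  · have h₁ : MulAction.stabilizer H (Sum.inl x : X ⊕ Y) = MulAction.stabilizer H x := by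
      ext; exact Sum.inl_injective.eq_iff
    have h₂ : MulAction.stabilizer Gᵐᵒᵖ (Sum.inl x : X ⊕ Y) = MulAction.stabilizer Gᵐᵒᵖ x := by
      ext; exact Sum.inl_injective.eq_iff
    exact ⟨h₁ ▸ (hX x).1, h₂ ▸ (hX x).2⟩
  · have h₁ : MulAction.stabilizer H (Sum.inr y : X ⊕ Y) = MulAction.stabilizer H y := by
      ext; exact Sum.inr_injective.eq_iff
    have h₂ : MulAction.stabilizer Gᵐᵒᵖ (Sum.inr y : X ⊕ Y) = MulAction.stabilizer Gᵐᵒᵖ y := by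
      ext; exact Sum.inr_injective.eq_iff
    exact ⟨h₁ ▸ (hY y).1, h₂ ▸ (hY y).2⟩

theorem Biset.isBifree_id [Finite G] : (Biset.id G).IsBifree p := by
  intro (x : G)
  have h₁ : MulAction.stabilizer G x = ⊥ := by
    ext g; simp
  have h₂ : MulAction.stabilizer Gᵐᵒᵖ x = ⊥ := by
    ext g; simp [MulAction.mem_stabilizer_iff, MulOpposite.smul_eq_mul_unop]
  constructor
  · change (Nat.card (MulAction.stabilizer G x)).Coprime p
    rw [h₁]; simp
  · change (Nat.card (MulAction.stabilizer Gᵐᵒᵖ x)).Coprime p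
    rw [h₂]; simp

theorem Biset.pow_smul_eq {A B X : Type*} [Group A] [Group B] [MulAction A X] [MulAction B X]
    [SMulCommClass A B X] {a : A} {b : B} {x : X} (h : a • x = b • x) (n : ℕ) :
    a ^ n • x = b ^ n • x := by
  induction n with
  | zero => simp
  | succ n ih => rw [pow_succ, mul_smul, h, smul_comm, ih, smul_smul, ← pow_succ']

/-- If every element of a finite group has a power, with exponent prime to `p`, lying in a
`p'`-subgroup, then the group is a `p'`-group. -/
theorem coprime_of_pow_mem [hp : Fact p.Prime] {A : Type*} [Group A] [Finite A] (S T : Subgroup A)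
    (hT : (Nat.card T).Coprime p) (h : ∀ a ∈ S, ∃ m : ℕ, m.Coprime p ∧ a ^ m ∈ T) :
    (Nat.card S).Coprime p := by
  rw [Nat.coprime_comm, hp.out.coprime_iff_not_dvd]
  intro hd
  obtain ⟨a, ha⟩ := exists_prime_orderOf_dvd_card' p hd
  obtain ⟨m, hm, hmem⟩ := h a a.2
  have h1 : ((a : A) ^ m) ^ Nat.card T = 1 := by
    have := pow_card_eq_one' (x := (⟨_, hmem⟩ : T))
    exact congrArg Subtype.val this
  rw [← pow_mul] at h1
  have h2 := orderOf_dvd_of_pow_eq_one h1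
  rw [Subgroup.orderOf_coe, ha] at h2
  have h3 : (m * Nat.card T).Coprime p := Nat.Coprime.mul_left hm hT
  exact (hp.out.coprime_iff_not_dvd.1 h3.symm) h2

theorem Biset.IsBifree.comp [Fact p.Prime] [Finite K] [Finite H] [Finite G] {X : Biset K H}
    {Y : Biset H G} (hX : X.IsBifree p) (hY : Y.IsBifree p) : (X.comp Y).IsBifree p := by
  intro (t : Tens H X Y)
  induction t using Tens.ind with | h x y =>
  constructor
  · refine coprime_of_pow_mem p _ (MulAction.stabilizer K x) (hX x).1 fun k hk => ?_
    obtain ⟨h, h₁, h₂⟩ := Tens.exact (G := H) (x := k • x) (x' := x) (u := y) (u' := y) hk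
    refine ⟨_, (hY y).1, ?_⟩
    rw [MulAction.mem_stabilizer_iff, Biset.pow_smul_eq h₁, ← op_pow]
    have : h ^ Nat.card (MulAction.stabilizer H y) = 1 :=
      congrArg Subtype.val (pow_card_eq_one' (x := (⟨h, h₂.symm⟩ : MulAction.stabilizer H y)))
    rw [this, op_one, one_smul]
  · have : Finite Gᵐᵒᵖ := Finite.of_equiv G opEquiv
    refine coprime_of_pow_mem p _ (MulAction.stabilizer Gᵐᵒᵖ y) (hY y).2 fun k hk => ?_
    obtain ⟨h, h₁, h₂⟩ := Tens.exact (G := H) (x := x) (x' := x) (u := k • y) (u' := y) hk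
    refine ⟨_, (hX x).2, ?_⟩
    have h₃ : h⁻¹ • y = k • y := by rw [inv_smul_eq_iff]; exact h₂
    rw [MulAction.mem_stabilizer_iff, ← Biset.pow_smul_eq h₃]
    have : (op h) ^ Nat.card (MulAction.stabilizer Hᵐᵒᵖ x) = 1 :=
      congrArg Subtype.val
        (pow_card_eq_one' (x := (⟨op h, h₁.symm⟩ : MulAction.stabilizer Hᵐᵒᵖ x)))
    rw [← op_pow, op_eq_one_iff] at this
    rw [inv_pow, this, inv_one, one_smul]

variable (H G)

/-- Isomorphism of `p`-bifree `(H, G)`-bisets. -/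
instance bisetSetoid : Setoid {X : Biset H G // X.IsBifree p} where
  r X Y := ∃ e : X.1 ≃ Y.1, (∀ (h : H) (x : X.1), e (h • x) = h • e x) ∧
    ∀ (g : G) (x : X.1), e (op g • x) = op g • e x
  iseqv :=
    { refl := fun _ => ⟨Equiv.refl _, fun _ _ => rfl, fun _ _ => rfl⟩
      symm := fun ⟨e, h, k⟩ => ⟨e.symm,
        fun g x => by rw [Equiv.symm_apply_eq, h, Equiv.apply_symm_apply],
        fun g x => by rw [Equiv.symm_apply_eq, k, Equiv.apply_symm_apply]⟩
      trans := fun ⟨e, h, k⟩ ⟨e', h', k'⟩ =>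
        ⟨e.trans e', fun g x => by simp [h, h'], fun g x => by simp [k, k']⟩ }

/-- The isomorphism classes of `p`-bifree `(H, G)`-bisets. -/
def BifreeClass : Type (u + 1) := Quotient (bisetSetoid H G p)

variable {H G} {p}

/-- The isomorphism class of a `p`-bifree biset. -/
def Biset.cls (X : Biset H G) (hX : X.IsBifree p) : BifreeClass H G p := Quotient.mk _ ⟨X, hX⟩

theorem Biset.cls_eq {X Y : Biset H G} (hX : X.IsBifree p) (hY : Y.IsBifree p) (e : X ≃ Y)
    (h : ∀ (h : H) (x : X), e (h • x) = h • e x) (k : ∀ (g : G) (x : X), e (op g • x) = op g • e x) :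
    X.cls hX = Y.cls hY := Quotient.sound ⟨e, h, k⟩

@[elab_as_elim]
theorem BifreeClass.ind {Q : BifreeClass H G p → Prop} (c : BifreeClass H G p)
    (h : ∀ (X : Biset H G) (hX : X.IsBifree p), Q (X.cls hX)) : Q c :=
  Quotient.inductionOn c fun X => h X.1 X.2

instance : Zero (BifreeClass H G p) := ⟨Biset.empty.cls (Biset.isBifree_empty p)⟩

instance : Add (BifreeClass H G p) where
  add := Quotient.map₂ (fun X Y => ⟨X.1.sum Y.1, X.2.sum p Y.2⟩) (by
    rintro X X' ⟨e, h, k⟩ Y Y' ⟨e', h', k'⟩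
    refine ⟨Equiv.sumCongr e e', ?_, ?_⟩
    · rintro g (x | y)
      · exact congrArg Sum.inl (h g x)
      · exact congrArg Sum.inr (h' g y)
    · rintro g (x | y)
      · exact congrArg Sum.inl (k g x)
      · exact congrArg Sum.inr (k' g y))

/-- Disjoint union makes the isomorphism classes of `p`-bifree bisets a commutative monoid. -/
instance : AddCommMonoid (BifreeClass H G p) where
  nsmul := nsmulRec
  add_assoc a b c := by
    induction a using BifreeClass.ind with | h X hX =>
    induction b using BifreeClass.ind with | h Y hY =>
    induction c using BifreeClass.ind with | h Z hZ =>
    exact Biset.cls_eq (X := (X.sum Y).sum Z) (Y := X.sum (Y.sum Z)) _ _ (Equiv.sumAssoc X Y Z)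
      (by rintro g ((x | y) | z) <;> rfl) (by rintro g ((x | y) | z) <;> rfl)
  zero_add a := by
    induction a using BifreeClass.ind with | h X hX =>
    exact Biset.cls_eq (X := Biset.empty.sum X) (Y := X) _ _ (Equiv.emptySum PEmpty X)
      (by rintro g (⟨⟨⟩⟩ | z); rfl) (by rintro g (⟨⟨⟩⟩ | z); rfl)
  add_zero a := by
    induction a using BifreeClass.ind with | h X hX =>
    exact Biset.cls_eq (X := X.sum Biset.empty) (Y := X) _ _ (Equiv.sumEmpty X PEmpty)
      (by rintro g (z | ⟨⟨⟩⟩); rfl) (by rintro g (z | ⟨⟨⟩⟩); rfl)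
  add_comm a b := by
    induction a using BifreeClass.ind with | h X hX =>
    induction b using BifreeClass.ind with | h Y hY =>
    exact Biset.cls_eq (X := X.sum Y) (Y := Y.sum X) _ _ (Equiv.sumComm X Y)
      (by rintro g (x | y) <;> rfl) (by rintro g (x | y) <;> rfl)

variable (H G p) in
/-- The group `B^Δ(H, G)`: the Grothendieck group of `p`-bifree `(H, G)`-bisets. -/
abbrev BDelta : Type (u + 1) := GrothendieckAddGroup (BifreeClass H G p)

/-- Composition of isomorphism classes of `p`-bifree bisets. -/
def BifreeClass.comp [Fact p.Prime] [Finite K] [Finite H] [Finite G] :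
    BifreeClass K H p → BifreeClass H G p → BifreeClass K G p :=
  Quotient.map₂ (fun X Y => ⟨X.1.comp Y.1, X.2.comp p Y.2⟩) (by
    rintro X X' ⟨e, h, k⟩ Y Y' ⟨e', h', k'⟩
    refine ⟨Tens.congr H e e' k h', fun g => Tens.ind fun x y => ?_,
      fun g => Tens.ind fun x y => ?_⟩
    · exact congrArg (fun z => Tens.mk H z (e' y)) (h g x)
    · exact congrArg (fun z => Tens.mk H (e x) z) (k' g y))

/-- Composition of isomorphism classes of `p`-bifree bisets, as a biadditive map. -/
def compHom [Fact p.Prime] [Finite K] [Finite H] [Finite G] :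
    BifreeClass K H p →+ BifreeClass H G p →+ BifreeClass K G p where
  toFun a :=
    { toFun := fun b => a.comp b
      map_zero' := by
        induction a using BifreeClass.ind with | h X hX =>
        exact Biset.cls_eq (X := X.comp Biset.empty) (Y := Biset.empty) _ _
          ⟨Tens.lift (fun _ y => y) fun _ _ y => y.elim, fun y => y.elim,
            Tens.ind fun _ y => y.elim, fun y => y.elim⟩
          (fun _ => Tens.ind fun _ y => y.elim) (fun _ => Tens.ind fun _ y => y.elim)
      map_add' := fun b c => by
        induction a using BifreeClass.ind with | h X hX =>
        induction b using BifreeClass.ind with | h Y hY =>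
        induction c using BifreeClass.ind with | h Z hZ =>
        exact Biset.cls_eq (X := X.comp (Y.sum Z)) (Y := (X.comp Y).sum (X.comp Z)) _ _
          (Tens.sumRight H X Y Z)
          (fun _ => Tens.ind fun _ s => by rcases s with y | z <;> rfl)
          (fun _ => Tens.ind fun _ s => by rcases s with y | z <;> rfl) }
  map_zero' := by
    ext b
    induction b using BifreeClass.ind with | h Y hY =>
    exact Biset.cls_eq (X := Biset.empty.comp Y) (Y := Biset.empty) _ _
      ⟨Tens.lift (fun x _ => x) fun _ x _ => x.elim, fun x => x.elim,
        Tens.ind fun x _ => x.elim, fun x => x.elim⟩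
      (fun _ => Tens.ind fun x _ => x.elim) (fun _ => Tens.ind fun x _ => x.elim)
  map_add' a b := by
    ext c
    induction a using BifreeClass.ind with | h X hX =>
    induction b using BifreeClass.ind with | h Y hY =>
    induction c using BifreeClass.ind with | h Z hZ =>
    exact Biset.cls_eq (X := (X.sum Y).comp Z) (Y := (X.comp Z).sum (Y.comp Z)) _ _
      (Tens.sumLeft H X Z Y)
      (fun _ => Tens.ind fun s _ => by rcases s with x | y <;> rfl)
      (fun _ => Tens.ind fun s _ => by rcases s with x | y <;> rfl)

/-- The action of isomorphism classes of `p`-bifree `(H, G)`-bisets on isomorphism classes of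
finite `G`-sets. -/
def BifreeClass.act : BifreeClass H G p → GSetClass G → GSetClass H :=
  Quotient.map₂ (fun X U => X.1.act U) (by
    rintro X X' ⟨e, h, k⟩ U U' ⟨f, h'⟩
    exact ⟨Tens.congr G e f k h', fun g => Tens.ind fun x u =>
      congrArg (fun z => Tens.mk G z (f u)) (h g x)⟩)

/-- The action of `p`-bifree bisets on finite `G`-sets, as a biadditive map. -/
def actHom : BifreeClass H G p →+ GSetClass G →+ GSetClass H where
  toFun a :=
    { toFun := fun b => a.act b
      map_zero' := by
        induction a using BifreeClass.ind with | h X hX =>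
        exact GSet.cls_eq (X := X.act GSet.empty) (Y := GSet.empty)
          ⟨Tens.lift (fun _ y => y) fun _ _ y => y.elim, fun y => y.elim,
            Tens.ind fun _ y => y.elim, fun y => y.elim⟩
          (fun _ => Tens.ind fun _ y => y.elim)
      map_add' := fun b c => by
        induction a using BifreeClass.ind with | h X hX =>
        induction b using GSetClass.ind with | h U =>
        induction c using GSetClass.ind with | h V =>
        exact GSet.cls_eq (X := X.act (U.sum V)) (Y := (X.act U).sum (X.act V))
          (Tens.sumRight G X U V)
          (fun _ => Tens.ind fun _ s => by rcases s with y | z <;> rfl) }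
  map_zero' := by
    ext b
    induction b using GSetClass.ind with | h U =>
    exact GSet.cls_eq (X := Biset.empty.act U) (Y := GSet.empty)
      ⟨Tens.lift (fun x _ => x) fun _ x _ => x.elim, fun x => x.elim,
        Tens.ind fun x _ => x.elim, fun x => x.elim⟩
      (fun _ => Tens.ind fun x _ => x.elim)
  map_add' a b := by
    ext c
    induction a using BifreeClass.ind with | h X hX =>
    induction b using BifreeClass.ind with | h Y hY =>
    induction c using GSetClass.ind with | h U =>
    exact GSet.cls_eq (X := (X.sum Y).act U) (Y := (X.act U).sum (Y.act U))
      (Tens.sumLeft G X U Y)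
      (fun _ => Tens.ind fun s _ => by rcases s with x | y <;> rfl)

variable (G p) in
/-- The class of the identity biset. -/
def idClass [Finite G] : BifreeClass G G p := (Biset.id G).cls (Biset.isBifree_id p)

section laws

variable [Finite G] [Finite H] [Finite K]

theorem id_compHom [Fact p.Prime] (a : BifreeClass H G p) : compHom (idClass H p) a = a := by
  induction a using BifreeClass.ind with | h X hX =>
  exact Biset.cls_eq (X := (Biset.id H).comp X) (Y := X) _ _ (Tens.idLeft H X)
    (fun h => Tens.ind fun k x => mul_smul h k x)
    (fun g => Tens.ind fun (k : H) x => smul_comm k (op g) x)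

theorem compHom_id [Fact p.Prime] (a : BifreeClass H G p) : compHom a (idClass G p) = a := by
  induction a using BifreeClass.ind with | h X hX =>
  exact Biset.cls_eq (X := X.comp (Biset.id G)) (Y := X) _ _ (Tens.idRight G X)
    (fun h => Tens.ind fun x (g : G) => (smul_comm h (op g) x).symm)
    (fun g => Tens.ind fun x k => mul_smul (op g) (op k) x)

theorem compHom_assoc [Fact p.Prime] {J : Type u} [Group J] [Finite J] (a : BifreeClass J K p)
    (b : BifreeClass K H p) (c : BifreeClass H G p) :
    compHom (compHom a b) c = compHom a (compHom b c) := by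
  induction a using BifreeClass.ind with | h X hX =>
  induction b using BifreeClass.ind with | h Y hY =>
  induction c using BifreeClass.ind with | h Z hZ =>
  refine Biset.cls_eq (X := (X.comp Y).comp Z) (Y := X.comp (Y.comp Z)) _ _ (Tens.assoc K H X Y Z)
    (fun h => Tens.ind fun t z => ?_) (fun g => Tens.ind fun t z => ?_)
  · induction t using Tens.ind with | h x y => rfl
  · induction t using Tens.ind with | h x y => rfl

theorem id_actHom (c : GSetClass G) : actHom (idClass G p) c = c := by
  induction c using GSetClass.ind with | h U =>
  exact GSet.cls_eq (X := (Biset.id G).act U) (Y := U) (Tens.idLeft G U)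
    (fun h => Tens.ind fun k x => mul_smul h k x)

theorem actHom_compHom [Fact p.Prime] (a : BifreeClass K H p) (b : BifreeClass H G p) (c : GSetClass G) :
    actHom (compHom a b) c = actHom a (actHom b c) := by
  induction a using BifreeClass.ind with | h X hX =>
  induction b using BifreeClass.ind with | h Y hY =>
  induction c using GSetClass.ind with | h U =>
  refine GSet.cls_eq (X := (X.comp Y).act U) (Y := X.act (Y.act U)) (Tens.assoc H G X Y U)
    (fun h => Tens.ind fun t z => ?_)
  induction t using Tens.ind with | h x y => rfl

end laws

end Biset

/-! ### The `p`-bifree biset category and the Burnside functor -/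

section Category

/-- The category `RC^Δ`: its objects are the finite groups. -/
structure BifreeCat (p : ℕ) (R : Type v) : Type (u + 1) where
  /-- the underlying finite group -/
  grp : FiniteGrp.{u}

variable (p : ℕ) [Fact p.Prime] (R : Type v) [CommRing R]

/-- Morphisms from `G` to `H` in `RC^Δ` are the elements of `R ⊗ B^Δ(H, G)`, and composition is
induced by the product of bisets. -/
instance : Category.{max v (u + 1)} (BifreeCat.{u, v} p R) where
  Hom G H := R ⊗[ℤ] BDelta H.grp G.grp p
  id G := 1 ⊗ₜ cl (idClass G.grp p)
  comp f g := scalarLift₂ R compHom g f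
  id_comp f := by
    induction f using scalar_ind with
    | h r a => rw [scalarLift₂_tmul, mul_one, compHom_id]
    | hadd x y hx hy => rw [map_add, LinearMap.add_apply, hx, hy]
  comp_id f := by
    induction f using scalar_ind with
    | h r a => rw [scalarLift₂_tmul, one_mul, id_compHom]
    | hadd x y hx hy => rw [map_add, hx, hy]
  assoc f g h := by
    induction f using scalar_ind with
    | hadd x y hx hy => simp only [map_add, hx, hy]
    | h r a =>
    induction g using scalar_ind with
    | hadd x y hx hy => simp only [map_add, LinearMap.add_apply, hx, hy]
    | h s b =>
    induction h using scalar_ind with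
    | hadd x y hx hy => simp only [map_add, LinearMap.add_apply, hx, hy]
    | h t c => simp only [scalarLift₂_tmul, compHom_assoc, mul_assoc]

instance homGroup (G H : BifreeCat.{u, v} p R) : AddCommGroup (G ⟶ H) :=
  inferInstanceAs (AddCommGroup (R ⊗[ℤ] BDelta H.grp G.grp p))

instance homModule (G H : BifreeCat.{u, v} p R) : Module R (G ⟶ H) :=
  inferInstanceAs (Module R (R ⊗[ℤ] BDelta H.grp G.grp p))

instance : Preadditive (BifreeCat.{u, v} p R) where
  add_comp _ _ _ f f' g := map_add (scalarLift₂ R compHom g) f f'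
  comp_add _ _ _ f g g' := by
    change scalarLift₂ R compHom (g + g') f = _
    rw [map_add]; rfl

instance : Linear R (BifreeCat.{u, v} p R) where
  smul_comp _ _ _ r f g := map_smul (scalarLift₂ R compHom g) r f
  comp_smul _ _ _ f r g := by
    change scalarLift₂ R compHom (r • g) f = _
    rw [map_smul]; rfl

/-- The Burnside functor `RB` on `RC^Δ`: it sends `G` to `RB(G)`, and `X` to `U ↦ X ×_G U`. -/
def burnsideFunctor : BifreeCat.{u, v} p R ⥤ ModuleCat.{max v (u + 1)} R where
  obj G := ModuleCat.of R (RBurnside G.grp R)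
  map {G H} f := ModuleCat.ofHom (scalarLift₂ R (actHom (H := H.grp) (G := G.grp) (p := p)) f)
  map_id G := by
    refine ModuleCat.hom_ext (LinearMap.ext fun x => ?_)
    change scalarLift₂ R actHom (1 ⊗ₜ cl (idClass G.grp p)) x = x
    induction x using scalar_ind with
    | h r a => rw [scalarLift₂_tmul, one_mul, id_actHom]
    | hadd x y hx hy => rw [map_add, hx, hy]
  map_comp f g := by
    refine ModuleCat.hom_ext (LinearMap.ext fun x => ?_)
    change scalarLift₂ R actHom (scalarLift₂ R compHom g f) x =
      scalarLift₂ R actHom g (scalarLift₂ R actHom f x)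
    induction x using scalar_ind with
    | hadd x y hx hy => simp only [map_add, hx, hy]
    | h r a =>
    induction f using scalar_ind with
    | hadd x y hx hy => simp only [map_add, LinearMap.add_apply, hx, hy]
    | h s b =>
    induction g using scalar_ind with
    | hadd x y hx hy => simp only [map_add, LinearMap.add_apply, hx, hy]
    | h t c => simp only [scalarLift₂_tmul, actHom_compHom, mul_assoc]

instance : (burnsideFunctor.{u, v} p R).Additive where
  map_add {_ _ f g} := ModuleCat.hom_ext (map_add (scalarLift₂ R actHom) f g)

instance : (burnsideFunctor.{u, v} p R).Linear R where
  map_smul f r := ModuleCat.hom_ext (map_smul (scalarLift₂ R actHom) r f)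

end Category

/-! ### Subfunctors -/

section Subfunctor

variable {C : Type*} [Category C] {R : Type v} [CommRing R]

/-- A subfunctor of a functor with values in `R`-modules: a family of submodules stable under all
morphisms. -/
@[ext]
structure SubmoduleFunctor (F : C ⥤ ModuleCat.{w} R) where
  /-- the evaluation at `X` -/
  obj : ∀ X : C, Submodule R (F.obj X)
  map_mem : ∀ {X Y : C} (f : X ⟶ Y) (x : F.obj X), x ∈ obj X → (F.map f).hom x ∈ obj Y

variable {F : C ⥤ ModuleCat.{w} R}

/-- Subfunctors are ordered by inclusion. -/
instance : PartialOrder (SubmoduleFunctor F) :=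
  PartialOrder.lift SubmoduleFunctor.obj fun _ _ => SubmoduleFunctor.ext

/-- The sum of a family of subfunctors. -/
def SubmoduleFunctor.sum {ι : Type*} (T : ι → SubmoduleFunctor F) : SubmoduleFunctor F where
  obj X := ⨆ i, (T i).obj X
  map_mem {X Y} f x hx := by
    have : (⨆ i, (T i).obj X) ≤ (⨆ i, (T i).obj Y).comap (F.map f).hom :=
      iSup_le fun i x hx => Submodule.mem_iSup_of_mem i ((T i).map_mem f x hx)
    exact this hx

/-- The subfunctor generated by an element `x` of `F(X)`. -/
def SubmoduleFunctor.generated {X : C} (x : F.obj X) : SubmoduleFunctor F where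
  obj Y := Submodule.span R (Set.range fun f : X ⟶ Y => (F.map f).hom x)
  map_mem {Y Z} g y hy := by
    have : Submodule.span R (Set.range fun f : X ⟶ Y => (F.map f).hom x) ≤
        (Submodule.span R (Set.range fun f : X ⟶ Z => (F.map f).hom x)).comap (F.map g).hom := by
      rw [Submodule.span_le]
      rintro _ ⟨f, rfl⟩
      exact Submodule.subset_span ⟨f ≫ g, by simp⟩
    exact this hy

end Subfunctor

/-! ### `B^Δ_p`-groups and the subfunctors `e^Δ_G` -/

section BGroup

open Classical in
/-- The deflation number `m_{G,N} = |G|⁻¹ ∑_{XN = G} |X| μ(X, G)`, where `X` runs over subgroups of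
`G` and `μ` is the Möbius function of the lattice of subgroups; for normal `N`, the subgroup `XN` is
`X ⊔ N`. -/
def deflationNumber (G : Type u) [Group G] [Finite G] (N : Subgroup G) : ℚ :=
  letI : Fintype (Subgroup G) := Fintype.ofFinite _
  letI : LocallyFiniteOrder (Subgroup G) := Fintype.toLocallyFiniteOrder
  (Nat.card G : ℚ)⁻¹ * ∑ X : Subgroup G with X ⊔ N = ⊤,
    (Nat.card X : ℚ) * IncidenceAlgebra.mu ℚ X ⊤

/-- `G` is a `B^Δ_p`-group if `m_{G,N} = 0` for every non-trivial normal `p'`-subgroup `N`. -/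
def IsBDeltaGroup (p : ℕ) (G : FiniteGrp.{u}) : Prop :=
  ∀ N : Subgroup G, N.Normal → N ≠ ⊥ → (Nat.card N).Coprime p → deflationNumber G N = 0

/-- The relation `G ≫ H`: `H` is isomorphic to a quotient of `G` by a normal `p'`-subgroup. -/
def Dominates (p : ℕ) (G H : FiniteGrp.{u}) : Prop :=
  ∃ (N : Subgroup G) (_ : N.Normal), (Nat.card N).Coprime p ∧ Nonempty (G ⧸ N ≃* H)

/-- `S` is a set of representatives of the isomorphism classes of `B^Δ_p`-groups. -/
def IsBDeltaRepresentatives (p : ℕ) (S : Set FiniteGrp.{u}) : Prop :=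
  (∀ G ∈ S, IsBDeltaGroup p G) ∧
    ∀ G : FiniteGrp.{u}, IsBDeltaGroup p G → ∃! H : FiniteGrp.{u}, H ∈ S ∧ Nonempty (G ≃* H)

theorem exists_bDeltaRepresentatives (p : ℕ) :
    ∃ S : Set FiniteGrp.{u}, IsBDeltaRepresentatives p S := by
  let s : Setoid {G : FiniteGrp.{u} // IsBDeltaGroup p G} :=
    { r := fun G H => Nonempty (G.1 ≃* H.1)
      iseqv := ⟨fun _ => ⟨MulEquiv.refl _⟩, fun ⟨e⟩ => ⟨e.symm⟩, fun ⟨e⟩ ⟨f⟩ => ⟨e.trans f⟩⟩ }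
  refine ⟨Set.range fun c : Quotient s => c.out.1, ?_, fun G hG => ?_⟩
  · rintro _ ⟨c, rfl⟩
    exact c.out.2
  · refine ⟨(Quotient.mk s ⟨G, hG⟩).out.1, ⟨⟨_, rfl⟩, ?_⟩, ?_⟩
    · exact s.symm (Quotient.mk_out (s := s) ⟨G, hG⟩)
    · rintro _ ⟨⟨c, rfl⟩, h⟩
      have : Quotient.mk s ⟨G, hG⟩ = c := by
        rw [← Quotient.out_eq c]
        exact Quotient.sound h
      rw [this]

/-- The closed subsets of `S`, ordered by inclusion. -/
abbrev ClosedSubset (p : ℕ) (S : Set FiniteGrp.{u}) : Type (u + 1) :=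
  {A : Set FiniteGrp.{u} // A ⊆ S ∧ ∀ H ∈ A, ∀ G ∈ S, Dominates p G H → G ∈ A}

/-- The subfunctor `e^Δ_G` of `KB` generated by the idempotent `e^G_G` of `KB(G)`. -/
def eDelta (p : ℕ) [Fact p.Prime] (K : Type v) [Field K] (G : FiniteGrp.{u}) :
    SubmoduleFunctor (burnsideFunctor.{u, v} p K) :=
  SubmoduleFunctor.generated (X := (⟨G⟩ : BifreeCat.{u, v} p K))
    (burnsideIdempotent K (⊤ : Subgroup G))

end BGroup

end PBifree

end

/-!
The marks separate the elements of `KB(G)`, and `e^G_G = |G|⁻¹ ∑_X |X| μ(X, G) [G ⧸ X]` is the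
idempotent whose mark is `1` at `G` and `0` at all proper subgroups; it is killed by restriction to
proper subgroups. By the Frobenius formula `[G ⧸ X] x = Ind_X Res_X x`, every `x` differs from
`e^G_G x = |x^G| e^G_G` by elements induced from restrictions of `x` to proper subgroups. Hence
`e^G_G` lies in `F(G)` as soon as `F(G)` contains an element of non-zero mark at `G`, and a
subfunctor `F` is determined by the groups `G` with `e^G_G ∈ F(G)`.

Inflating `e^{G/N}_{G/N}` to `G` gives mark `1` at `G`, and deflating `e^G_G` to `G ⧸ N` gives mark
`m_{G,N}`. So `e^Δ_G ⊆ e^Δ_{G/N}`, with equality if `m_{G,N} ≠ 0`, and by induction on the order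
every `e^Δ_G` equals `e^Δ_H` for a `B^Δ_p`-group `H`.

For a `B^Δ_p`-group `H`, the mark at `G` is non-zero on `e^Δ_H(G)` only if `G ≫ H`. Indeed, let `X`
be a transitive `(G, H)`-biset such that `X e^H_H` has non-zero mark. A fixed point of `G` on some
`X ×_H U` makes `X` transitive on the right; since `e^H_H` restricts to `0` on proper subgroups, `X`
is also transitive on the left, and then the mark is `m_{H,N}` for the right stabilizer `N`, a
normal `p'`-subgroup. Thus `N = 1`, and `X` comes from an epimorphism `G → H` whose kernel is the
left stabilizer.
-/

noncomputable section

namespace PBifree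

section PrimitiveIdempotent

variable {R A : Type*} [CommRing A]

theorem IsPrimitiveIdempotent.eq_of_mul_eq {e f : A} (he : IsPrimitiveIdempotent e)
    (hf : IsIdempotentElem f) (hf₀ : f ≠ 0) (hfe : f * e = f) : f = e := by
  have hsub : IsIdempotentElem (e - f) := by
    rw [IsIdempotentElem, sub_mul, mul_sub, mul_sub, he.1, hf, hfe, mul_comm e, hfe, sub_self,
      sub_zero]
  have horth : f * (e - f) = 0 := by rw [mul_sub, hfe, hf, sub_self]
  have := (he.2.2 f (e - f) hf hsub horth (add_sub_cancel f e)).resolve_left hf₀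
  exact (sub_eq_zero.1 this).symm

theorem isPrimitiveIdempotent_of_mul_eq_smul [CommRing R] [IsDomain R] [Algebra R A]
    (φ : A →ₐ[R] R) {e : A} (hφ : φ e = 1) (he : ∀ x, e * x = φ x • e) :
    IsPrimitiveIdempotent e := by
  refine ⟨by rw [IsIdempotentElem, he, hφ, one_smul], ?_, fun a b ha hb hab h => ?_⟩
  · rintro rfl
    exact zero_ne_one (φ.map_zero.symm.trans hφ)
  have ha' : φ a • e = a := by rw [← he, ← h, add_mul, ha, mul_comm b, hab, add_zero]
  have hb' : φ b • e = b := by rw [← he, ← h, add_mul, hb, hab, zero_add]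
  have hφab : φ a * φ b = 0 := by rw [← map_mul, hab, map_zero]
  exact (mul_eq_zero.1 hφab).imp (fun h₀ => by rw [← ha', h₀, zero_smul])
    (fun h₀ => by rw [← hb', h₀, zero_smul])

end PrimitiveIdempotent

section Actions

open Classical in
theorem card_fixedPoints_top_of_isPretransitive (G X : Type*) [Group G] [MulAction G X]
    [MulAction.IsPretransitive G X] [Nonempty X] :
    Nat.card (MulAction.fixedPoints (⊤ : Subgroup G) X) = if Subsingleton X then 1 else 0 := by
  split_ifs with hX
  · rw [MulAction.fixedPoints_of_subsingleton, Nat.card_univ, Nat.card_eq_one_iff_unique]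
    exact ⟨hX, inferInstance⟩
  · rw [Nat.card_eq_zero]
    refine .inl ⟨fun ⟨x, hx⟩ => hX ⟨fun y z => ?_⟩⟩
    have eq_x (w : X) : w = x := by
      obtain ⟨g, rfl⟩ := MulAction.exists_smul_eq G x w
      exact hx ⟨g, trivial⟩
    rw [eq_x y, eq_x z]

theorem card_mul_card_fixedPoints_quotient {G : Type*} [Group G] (X L : Subgroup G) :
    Nat.card X * Nat.card (MulAction.fixedPoints L (G ⧸ X)) =
      Nat.card {g : G // L.map (MulAut.conj g⁻¹).toMonoidHom ≤ X} := by
  rw [← Nat.card_prod, ← Nat.card_congr (QuotientGroup.preimageMkEquivSubgroupProdSet X _)]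
  refine Nat.card_congr (Equiv.subtypeEquivRight fun g => ?_)
  rw [Set.mem_preimage, Subgroup.map_le_iff_le_comap, MulAction.mem_fixedPoints, SetLike.le_def,
    Subtype.forall]
  refine forall₂_congr fun l hl => ?_
  change ((l * g : G) : G ⧸ X) = (g : G ⧸ X) ↔ _
  rw [eq_comm, QuotientGroup.eq, Subgroup.mem_comap]
  simp [mul_assoc]

theorem stabilizer_normal_of_isPretransitive {A B X : Type*} [Group A] [Group B] [MulAction A X]
    [MulAction B X] [SMulCommClass A B X] [MulAction.IsPretransitive A X] (x : X) :
    (MulAction.stabilizer B x).Normal := by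
  refine ⟨fun n hn b => ?_⟩
  rw [MulAction.mem_stabilizer_iff] at hn ⊢
  obtain ⟨a, ha⟩ := MulAction.exists_smul_eq A x (b⁻¹ • x)
  rw [mul_smul, mul_smul, ← ha, ← smul_comm a n x, hn, ha, smul_inv_smul]

theorem map_subtype_ne_top {G : Type*} [Group G] {X : Subgroup G} (hX : X ≠ ⊤) (L : Subgroup X) :
    L.map X.subtype ≠ ⊤ :=
  fun h => hX (top_le_iff.1 (h ▸ Subgroup.map_subtype_le L))

theorem card_lt_card_of_ne_top {G : Type*} [Group G] [Finite G] {X : Subgroup G} (hX : X ≠ ⊤) :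
    Nat.card X < Nat.card G :=
  (Subgroup.card_le_card_group X).lt_of_ne fun h => hX (Subgroup.eq_top_of_card_eq X h)

theorem map_conj_eq_top_iff {G : Type*} [Group G] (L : Subgroup G) (g : G) :
    L.map (MulAut.conj g).toMonoidHom = ⊤ ↔ L = ⊤ :=
  (Subgroup.map_injective (MulAut.conj g).injective).eq_iff'
    (Subgroup.map_top_of_surjective _ (MulAut.conj g).surjective)

end Actions

section BurnsideAlgebra

variable {G : Type u} [Group G] (R : Type v) [CommRing R]

/-- The class `[U]` of a finite `G`-set in `RB(G)`. -/
def GSet.toRBurnside (U : GSet G) : RBurnside G R := 1 ⊗ₜ cl U.cls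

variable {R}

theorem tmul_cl_eq_smul {M : Type*} [AddCommMonoid M] (r : R) (m : M) :
    r ⊗ₜ[ℤ] cl m = r • ((1 : R) ⊗ₜ[ℤ] cl m) := by
  rw [TensorProduct.smul_tmul', smul_eq_mul, mul_one]

theorem RBurnside.linearMap_ext {A : Type*} [AddCommGroup A] [Module R A]
    {f g : RBurnside G R →ₗ[R] A} (h : ∀ U : GSet G, f (U.toRBurnside R) = g (U.toRBurnside R)) :
    f = g := by
  refine LinearMap.ext fun x => ?_
  induction x using scalar_ind with
  | h r m =>
    induction m using GSetClass.ind with | h U =>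
    rw [tmul_cl_eq_smul, map_smul, map_smul]
    exact congrArg (r • ·) (h U)
  | hadd x y hx hy => rw [map_add, map_add, hx, hy]

variable (R)

theorem GSet.toRBurnside_congr {U V : GSet G} (e : U ≃ V)
    (h : ∀ (g : G) (x : U), e (g • x) = g • e x) : U.toRBurnside R = V.toRBurnside R := by
  rw [GSet.toRBurnside, GSet.cls_eq e h, GSet.toRBurnside]

theorem GSet.toRBurnside_prod (U V : GSet G) :
    (U.prod V).toRBurnside R = U.toRBurnside R * V.toRBurnside R := by
  rw [GSet.toRBurnside, GSet.toRBurnside, GSet.toRBurnside,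
    Algebra.TensorProduct.tmul_mul_tmul, one_mul]
  exact congrArg _ (grLift₂_cl (AddMonoidHom.mul (R := GSetClass G)) U.cls V.cls).symm

theorem GSet.toRBurnside_of_unique (U : GSet G) [Unique U] : U.toRBurnside R = 1 :=
  GSet.toRBurnside_congr R (V := GSet.point) (Equiv.ofUnique U PUnit.{u + 1}) fun _ _ => rfl

theorem mark_toRBurnside (L : Subgroup G) (U : GSet G) :
    mark R L (U.toRBurnside R) = (Nat.card (MulAction.fixedPoints L U) : R) := by
  rw [mark, GSet.toRBurnside, LinearMap.liftBaseChange_tmul, one_smul]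
  exact lift_cl _ _

theorem mark_one (L : Subgroup G) : mark R L 1 = 1 := by
  have : Unique (GSet.point : GSet G) := inferInstanceAs (Unique PUnit)
  rw [← GSet.toRBurnside_of_unique R (GSet.point : GSet G), mark_toRBurnside,
    MulAction.fixedPoints_of_subsingleton, Nat.card_univ, Nat.card_unique, Nat.cast_one]

theorem mark_mul (L : Subgroup G) (x y : RBurnside G R) :
    mark R L (x * y) = mark R L x * mark R L y := by
  suffices (LinearMap.mul R (RBurnside G R)).compr₂ (mark R L) =
      (LinearMap.mul R R).compl₁₂ (mark R L) (mark R L) from LinearMap.congr_fun₂ this x y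
  refine RBurnside.linearMap_ext fun U => RBurnside.linearMap_ext fun V => ?_
  simp only [LinearMap.compr₂_apply, LinearMap.mul_apply', LinearMap.compl₁₂_apply,
    ← GSet.toRBurnside_prod, mark_toRBurnside, ← Nat.cast_mul, ← Nat.card_prod]
  refine congrArg Nat.cast (Nat.card_congr ?_)
  exact
    { toFun := fun x => (⟨x.1.1, fun l => congrArg Prod.fst (x.2 l)⟩,
        ⟨x.1.2, fun l => congrArg Prod.snd (x.2 l)⟩)
      invFun := fun x => ⟨(x.1.1, x.2.1), fun l => Prod.ext (x.1.2 l) (x.2.2 l)⟩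
      left_inv := fun _ => rfl
      right_inv := fun _ => rfl }

/-- The mark at `L` as a homomorphism of algebras. -/
def markAlgHom (L : Subgroup G) : RBurnside G R →ₐ[R] R :=
  AlgHom.ofLinearMap (mark R L) (mark_one R L) (mark_mul R L)

end BurnsideAlgebra

section BisetAction

variable {G H : Type u} [Group G] [Group H] (R : Type v) [CommRing R]

theorem Biset.isBifree_one (X : Biset H G) : X.IsBifree 1 :=
  fun _ => ⟨Nat.coprime_one_right _, Nat.coprime_one_right _⟩

/-- The linear map `RB(G) → RB(H)`, `[U] ↦ [X ×_G U]`, of an arbitrary biset `X`. It is read off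
from the action of `p`-bifree bisets at `p = 1`, where bifreeness is no condition. -/
def Biset.burnsideMap (X : Biset H G) : RBurnside G R →ₗ[R] RBurnside H R :=
  scalarLift₂ R actHom (1 ⊗ₜ cl (X.cls X.isBifree_one))

theorem Biset.burnsideMap_toRBurnside (X : Biset H G) (U : GSet G) :
    X.burnsideMap R (U.toRBurnside R) = (X.act U).toRBurnside R := by
  rw [Biset.burnsideMap, GSet.toRBurnside, scalarLift₂_tmul, one_mul]; rfl

variable {R}

theorem scalarLift₂_actHom_tmul_cls {p : ℕ} {X : Biset H G} (hX : X.IsBifree p) (r : R) :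
    scalarLift₂ R actHom (r ⊗ₜ cl (X.cls hX)) = r • X.burnsideMap R := by
  refine RBurnside.linearMap_ext fun U => ?_
  rw [tmul_cl_eq_smul, map_smul, LinearMap.smul_apply, LinearMap.smul_apply,
    Biset.burnsideMap_toRBurnside, GSet.toRBurnside, scalarLift₂_tmul, one_mul]
  rfl

end BisetAction

section Orbits

variable {G H : Type u} [Group G] [Group H]

/-- The transitive `G`-set `G ⧸ X`. -/
def GSet.quotient [Finite G] (X : Subgroup G) : GSet G where
  carrier := G ⧸ X

theorem GSet.toRBurnside_quotient_top [Finite G] (R : Type v) [CommRing R] :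
    (GSet.quotient (⊤ : Subgroup G)).toRBurnside R = 1 := by
  have : Subsingleton (G ⧸ (⊤ : Subgroup G)) := QuotientGroup.subsingleton_quotient_top
  have : Unique (GSet.quotient (⊤ : Subgroup G)) := Unique.mk' (G ⧸ (⊤ : Subgroup G))
  exact GSet.toRBurnside_of_unique R _

/-- A stable subset of a `G`-set, as a `G`-set. -/
def GSet.sub (U : GSet G) (S : SubMulAction G U) : GSet G where
  carrier := S

open Classical in
theorem GSet.cls_eq_sub_add (U : GSet G) (S : SubMulAction G U) :
    U.cls = (U.sub S).cls + (U.sub Sᶜ).cls :=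
  (GSet.cls_eq (X := (U.sub S).sum (U.sub Sᶜ)) (Y := U) (Equiv.Set.sumCompl (S : Set U))
    (by rintro g (x | x) <;> rfl)).symm

theorem GSet.cls_eq_zero (U : GSet G) [IsEmpty U] : U.cls = 0 :=
  GSet.cls_eq (Y := GSet.empty) (Equiv.equivPEmpty U) fun _ x => isEmptyElim x

theorem GSet.cls_eq_quotient_of_coe_eq_orbit [Finite G] {U : GSet G} {S : SubMulAction G U} {u : U}
    (hS : (S : Set U) = MulAction.orbit G u) :
    (U.sub S).cls = (GSet.quotient (MulAction.stabilizer G u)).cls := by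
  refine (GSet.cls_eq (X := GSet.quotient (MulAction.stabilizer G u)) (Y := U.sub S)
    ((MulAction.orbitEquivQuotientStabilizer G u).symm.trans (Equiv.setCongr hS.symm))
    fun g q => ?_).symm
  induction q using QuotientGroup.induction_on with
  | H x => exact Subtype.ext (mul_smul g x u)

@[elab_as_elim]
theorem GSetClass.orbit_induction [Finite G] {Q : GSetClass G → Prop} (c : GSetClass G)
    (zero : Q 0) (quotient : ∀ X : Subgroup G, Q (GSet.quotient X).cls)
    (add : ∀ a b, Q a → Q b → Q (a + b)) : Q c := by
  induction c using GSetClass.ind with | h U =>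
  induction hn : Nat.card U using Nat.strong_induction_on generalizing U with
  | h n ih =>
  rcases isEmpty_or_nonempty U with hU | ⟨⟨u⟩⟩
  · rwa [U.cls_eq_zero]
  · let S : SubMulAction G U :=
      ⟨MulAction.orbit G u, fun g _ hx => MulAction.mem_orbit_of_mem_orbit g hx⟩
    rw [U.cls_eq_sub_add S, GSet.cls_eq_quotient_of_coe_eq_orbit (S := S) rfl]
    refine add _ _ (quotient _) (ih _ ?_ (U.sub Sᶜ) rfl)
    rw [← hn]
    exact Finite.card_subtype_lt (p := (· ∈ Sᶜ)) (x := u) fun h => h (MulAction.mem_orbit_self u)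

/-- A biset is pretransitive if the two actions together have at most one orbit; as for
`MulAction.IsPretransitive`, the empty biset is allowed. -/
def Biset.IsPretransitive (X : Biset H G) : Prop :=
  ∀ x y : X, ∃ (h : H) (g : G), y = h • op g • x

/-- A subset of a biset stable under both actions, as a biset. -/
def Biset.sub (X : Biset H G) (S : SubMulAction H X) (hS : ∀ g : Gᵐᵒᵖ, ∀ x ∈ S, g • x ∈ S) :
    Biset H G where
  carrier := S
  right := inferInstanceAs (MulAction Gᵐᵒᵖ (⟨S, fun g _ => hS g _⟩ : SubMulAction Gᵐᵒᵖ X))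
  comm := @SMulCommClass.mk _ _ _ (_) (_) fun h g x => Subtype.ext (smul_comm h g x.1)

theorem Biset.IsBifree.sub {p : ℕ} {X : Biset H G} (hX : X.IsBifree p) (S : SubMulAction H X)
    (hS : ∀ g : Gᵐᵒᵖ, ∀ x ∈ S, g • x ∈ S) : (X.sub S hS).IsBifree p := by
  intro x
  have hl : MulAction.stabilizer H x = MulAction.stabilizer H x.1 :=
    SubMulAction.stabilizer_of_subMul (p := S) x
  have hr : MulAction.stabilizer Gᵐᵒᵖ x = MulAction.stabilizer Gᵐᵒᵖ x.1 := by
    ext; exact Subtype.ext_iff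
  exact ⟨hl ▸ (hX x.1).1, hr ▸ (hX x.1).2⟩

theorem smul_mem_compl {A X : Type*} [Group A] [MulAction A X] {S : Set X}
    (hS : ∀ a : A, ∀ x ∈ S, a • x ∈ S) (a : A) (x : X) (hx : x ∈ Sᶜ) : a • x ∈ Sᶜ :=
  (⟨S, fun a _ => hS a _⟩ : SubMulAction A X)ᶜ.smul_mem a hx

open Classical in
theorem Biset.cls_eq_sub_add {p : ℕ} {X : Biset H G} (hX : X.IsBifree p) (S : SubMulAction H X)
    (hS : ∀ g : Gᵐᵒᵖ, ∀ x ∈ S, g • x ∈ S) :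
    X.cls hX = (X.sub S hS).cls (hX.sub S hS) +
      (X.sub Sᶜ (smul_mem_compl hS)).cls (hX.sub Sᶜ (smul_mem_compl hS)) :=
  (Biset.cls_eq (X := (X.sub S hS).sum (X.sub Sᶜ (smul_mem_compl hS))) (Y := X) _ _
    (Equiv.Set.sumCompl (S : Set X)) (by rintro h (x | x) <;> rfl)
    (by rintro g (x | x) <;> rfl)).symm

@[elab_as_elim]
theorem BifreeClass.orbit_induction {p : ℕ} {Q : BifreeClass H G p → Prop} (c : BifreeClass H G p)
    (pretransitive : ∀ (X : Biset H G) (hX : X.IsBifree p), X.IsPretransitive → Q (X.cls hX))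
    (add : ∀ a b, Q a → Q b → Q (a + b)) : Q c := by
  induction c using BifreeClass.ind with | h X hX =>
  induction hn : Nat.card X using Nat.strong_induction_on generalizing X with
  | h n ih =>
  by_cases htr : X.IsPretransitive
  · exact pretransitive X hX htr
  · obtain ⟨x, y, hxy⟩ : ∃ x y : X, ∀ (h : H) (g : G), y ≠ h • op g • x := by
      simpa only [Biset.IsPretransitive, not_forall, not_exists] using htr
    let S : SubMulAction H X := ⟨{z | ∃ (h : H) (g : G), z = h • op g • x}, by
      rintro k _ ⟨h, g, rfl⟩
      exact ⟨k * h, g, (mul_smul k h _).symm⟩⟩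
    have hS (k : Gᵐᵒᵖ) (z : X) (hz : z ∈ S) : k • z ∈ S := by
      obtain ⟨h, g, rfl⟩ := hz
      exact ⟨h, g * k.unop, by rw [← smul_comm, smul_smul, op_mul, op_unop]⟩
    have hx : x ∈ S := ⟨1, 1, by simp⟩
    have hy : y ∉ S := fun ⟨h, g, hy⟩ => hxy h g hy
    rw [Biset.cls_eq_sub_add hX S hS]
    refine add _ _ (ih _ ?_ (X.sub S hS) _ rfl) (ih _ ?_ (X.sub Sᶜ _) _ rfl)
    · exact hn ▸ Finite.card_subtype_lt (p := (· ∈ S)) hy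
    · exact hn ▸ Finite.card_subtype_lt (p := (· ∈ Sᶜ)) fun h => h hx

end Orbits

section HomBisets

variable {G H : Type u} [Group G] [Group H]

/-- The restriction of an `H`-set along `f : G → H`. -/
def GSet.comap (f : G →* H) (U : GSet H) : GSet G where
  carrier := U
  act := MulAction.compHom U f

variable [Finite H] (f : G →* H) {p : ℕ} (R : Type v) [CommRing R]

/-- The `(G, H)`-biset `H`, on which `G` acts through `f : G → H`; it induces restriction
along `f`. -/
def Biset.pullback : Biset G H where
  carrier := H
  left := MulAction.compHom H f
  comm := letI := MulAction.compHom H f; ⟨fun g h x => (mul_assoc (f g) x h.unop).symm⟩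

/-- The `(H, G)`-biset `H`, on which `G` acts through `f : G → H`; it induces induction along an
injective `f` and deflation along a surjective `f`. -/
def Biset.pushforward : Biset H G where
  carrier := H
  right := MulAction.compHom H (MonoidHom.op f)
  comm := letI := MulAction.compHom H (MonoidHom.op f)
    ⟨fun h g x => (mul_assoc h x (f g.unop)).symm⟩

variable {f}

theorem Biset.isBifree_pullback (hf : (Nat.card f.ker).Coprime p) :
    (Biset.pullback f).IsBifree p := by
  intro (x : H)
  have hl : MulAction.stabilizer G (show Biset.pullback f from x) = f.ker := by
    ext g
    exact mul_eq_right (M := H)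
  exact ⟨hl ▸ hf, (Biset.isBifree_id p x).2⟩

theorem Biset.stabilizer_pushforward (x : Biset.pushforward f) :
    MulAction.stabilizer Gᵐᵒᵖ x = f.ker.op := by
  ext g
  exact mul_eq_left (M := H)

theorem Biset.isBifree_pushforward (hf : (Nat.card f.ker).Coprime p) :
    (Biset.pushforward f).IsBifree p := by
  intro (x : H)
  have hr := Biset.stabilizer_pushforward (show Biset.pushforward f from x)
  refine ⟨(Biset.isBifree_id p x).1, ?_⟩
  have hcard : Nat.card f.ker.op = Nat.card f.ker := Nat.card_congr f.ker.equivOp.symm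
  exact hr ▸ hcard ▸ hf

variable (f)

theorem Biset.burnsideMap_pullback_toRBurnside (U : GSet H) :
    (Biset.pullback f).burnsideMap R (U.toRBurnside R) = (U.comap f).toRBurnside R := by
  rw [Biset.burnsideMap_toRBurnside]
  refine GSet.toRBurnside_congr R (V := U.comap f) (Tens.idLeft H U) fun g => Tens.ind fun h u => ?_
  exact mul_smul (f g) h u

theorem mark_burnsideMap_pullback (L : Subgroup G) (x : RBurnside H R) :
    mark R L ((Biset.pullback f).burnsideMap R x) = mark R (L.map f) x := by
  suffices mark R L ∘ₗ (Biset.pullback f).burnsideMap R = mark R (L.map f) from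
    LinearMap.congr_fun this x
  refine RBurnside.linearMap_ext fun U => ?_
  rw [LinearMap.comp_apply, Biset.burnsideMap_pullback_toRBurnside, mark_toRBurnside,
    mark_toRBurnside]
  refine congrArg Nat.cast (Nat.card_congr (Equiv.subtypeEquivRight fun (u : U) => ?_))
  exact ⟨by rintro h ⟨_, l, hl, rfl⟩; exact h ⟨l, hl⟩, fun h l => h ⟨f l, l, l.2, rfl⟩⟩

end HomBisets

section Induction

variable {G : Type u} [Group G] [Finite G] (X : Subgroup G) (V : GSet G)

variable {X V} in
theorem pushforward_tensMk_eq {g g' : G} {v v' : V} (hg : g⁻¹ * g' ∈ X) (hv : g • v = g' • v') :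
    Tens.mk X (show Biset.pushforward X.subtype from g) (show V.comap X.subtype from v) =
      Tens.mk X (show Biset.pushforward X.subtype from g') (show V.comap X.subtype from v') := by
  have hg' : op (⟨_, hg⟩ : X) • (show Biset.pushforward X.subtype from g) = g' :=
    mul_inv_cancel_left g g'
  have hv' : (⟨_, hg⟩ : X) • (show V.comap X.subtype from v') = v :=
    (mul_smul g⁻¹ g' v').trans (inv_smul_eq_iff.2 hv.symm)
  rw [← hg', ← hv', Tens.mk_smul]

/-- The bijection `G ×_X V ≃ G ⧸ X × V`, `[g, v] ↦ (g X, g v)`, behind the Frobenius formula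
`Ind Res [V] = [G ⧸ X] [V]`. -/
def inductionEquiv :
    (Biset.pushforward X.subtype).act (V.comap X.subtype) ≃ (GSet.quotient X).prod V :=
  Equiv.ofBijective
    (Tens.lift (fun (g : G) (v : V) => ((g : G ⧸ X), g • v)) fun x (g : G) (v : V) =>
      Prod.ext (QuotientGroup.mk_mul_of_mem (s := X) g x.2) (mul_smul g (x : G) v)) <| by
    constructor
    · refine Tens.ind fun (g : G) v => Tens.ind fun (g' : G) v' h => ?_
      exact pushforward_tensMk_eq (QuotientGroup.eq.1 (congrArg Prod.fst h)) (congrArg Prod.snd h)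
    · rintro ⟨q, v⟩
      obtain ⟨g, rfl⟩ := QuotientGroup.mk_surjective (s := X) q
      exact ⟨Tens.mk X (show Biset.pushforward X.subtype from g)
        (show V.comap X.subtype from g⁻¹ • v), Prod.ext rfl (smul_inv_smul g v)⟩

theorem burnsideMap_pushforward_pullback (R : Type v) [CommRing R] (x : RBurnside G R) :
    (Biset.pushforward X.subtype).burnsideMap R ((Biset.pullback X.subtype).burnsideMap R x) =
      (GSet.quotient X).toRBurnside R * x := by
  suffices (Biset.pushforward X.subtype).burnsideMap R ∘ₗ
        (Biset.pullback X.subtype).burnsideMap R =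
      LinearMap.mulLeft R ((GSet.quotient X).toRBurnside R) from LinearMap.congr_fun this x
  refine RBurnside.linearMap_ext fun V => ?_
  rw [LinearMap.comp_apply, LinearMap.mulLeft_apply, Biset.burnsideMap_pullback_toRBurnside,
    Biset.burnsideMap_toRBurnside, ← GSet.toRBurnside_prod]
  exact GSet.toRBurnside_congr R (inductionEquiv X V) fun g => Tens.ind fun (k : G) (v : V) =>
    Prod.ext rfl (mul_smul g k v)

end Induction

section TopIdempotent

attribute [local instance] Fintype.ofFinite Fintype.toLocallyFiniteOrder

open Classical in
theorem sum_mu_top_of_le {P : Type*} [PartialOrder P] [OrderTop P] [Finite P] (a : P) :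
    ∑ x : P with a ≤ x, IncidenceAlgebra.mu ℚ x ⊤ = if a = ⊤ then 1 else 0 := by
  rw [← IncidenceAlgebra.sum_Icc_mu_left (𝕜 := ℚ) a ⊤]
  exact Finset.sum_congr (by ext; simp) fun _ _ => rfl

variable {G : Type u} [Group G] [Finite G]

open Classical in
/-- The coefficient `|X| μ(X, G) / |G|` of `[G ⧸ X]` in the idempotent `e^G_G`. -/
def idempotentCoeff (X : Subgroup G) : ℚ :=
  (Nat.card G : ℚ)⁻¹ * (Nat.card X * IncidenceAlgebra.mu ℚ X ⊤)

theorem idempotentCoeff_top : idempotentCoeff (⊤ : Subgroup G) = 1 := by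
  simp [idempotentCoeff]

open Classical in
theorem deflationNumber_eq_sum_idempotentCoeff (N : Subgroup G) :
    deflationNumber G N = ∑ X : Subgroup G, idempotentCoeff X * if X ⊔ N = ⊤ then 1 else 0 := by
  simp only [deflationNumber, idempotentCoeff, Finset.mul_sum, Finset.sum_filter, mul_ite, mul_one,
    mul_zero]

open Classical in
theorem sum_idempotentCoeff_mul_card_fixedPoints (L : Subgroup G) :
    ∑ X : Subgroup G, idempotentCoeff X * (Nat.card (MulAction.fixedPoints L (G ⧸ X)) : ℚ) =
      if L = ⊤ then 1 else 0 := by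
  have term_eq (X : Subgroup G) :
      idempotentCoeff X * (Nat.card (MulAction.fixedPoints L (G ⧸ X)) : ℚ) =
        (Nat.card G : ℚ)⁻¹ * ∑ g : G, if L.map (MulAut.conj g⁻¹).toMonoidHom ≤ X then
          IncidenceAlgebra.mu ℚ X ⊤ else 0 := by
    rw [idempotentCoeff, mul_assoc, mul_right_comm, ← Nat.cast_mul,
      card_mul_card_fixedPoints_quotient, Nat.card_eq_fintype_card (α := {g : G // _}),
      Fintype.card_subtype, ← Finset.sum_filter, Finset.sum_const, nsmul_eq_mul]
  calc ∑ X : Subgroup G, idempotentCoeff X * (Nat.card (MulAction.fixedPoints L (G ⧸ X)) : ℚ)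
      = (Nat.card G : ℚ)⁻¹ * ∑ g : G, ∑ X : Subgroup G with
          L.map (MulAut.conj g⁻¹).toMonoidHom ≤ X, IncidenceAlgebra.mu ℚ X ⊤ := by
        simp_rw [term_eq, ← Finset.mul_sum, Finset.sum_filter]
        rw [Finset.sum_comm]
    _ = (Nat.card G : ℚ)⁻¹ * ∑ _g : G, if L = ⊤ then 1 else 0 := by
        simp_rw [sum_mu_top_of_le, map_conj_eq_top_iff]
    _ = if L = ⊤ then 1 else 0 := by
        rw [Finset.sum_const, nsmul_eq_mul, ← mul_assoc, Finset.card_univ,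
          ← Nat.card_eq_fintype_card, inv_mul_cancel₀ (Nat.cast_ne_zero.2 Nat.card_pos.ne'),
          one_mul]

variable (K : Type v) [Field K]

variable (G) in
/-- The explicit form `|G|⁻¹ ∑_X |X| μ(X, G) [G ⧸ X]` of the idempotent `e^G_G`. -/
def topIdempotent : RBurnside G K :=
  ∑ X : Subgroup G, (idempotentCoeff X : K) • (GSet.quotient X).toRBurnside K

theorem topIdempotent_mul_eq_sum (x : RBurnside G K) :
    topIdempotent G K * x = ∑ X : Subgroup G, (idempotentCoeff X : K) •
      (Biset.pushforward X.subtype).burnsideMap K ((Biset.pullback X.subtype).burnsideMap K x) := by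
  simp_rw [burnsideMap_pushforward_pullback, topIdempotent, Finset.sum_mul, smul_mul_assoc]

open Classical in
theorem eq_topIdempotent_mul_sub_sum (x : RBurnside G K) :
    x = topIdempotent G K * x - ∑ X : Subgroup G with X ≠ ⊤, (idempotentCoeff X : K) •
      (Biset.pushforward X.subtype).burnsideMap K
        ((Biset.pullback X.subtype).burnsideMap K x) := by
  rw [topIdempotent_mul_eq_sum, ← Finset.sum_erase_add _ _ (Finset.mem_univ ⊤),
    burnsideMap_pushforward_pullback, idempotentCoeff_top, GSet.toRBurnside_quotient_top,
    Rat.cast_one, one_smul, one_mul, eq_sub_iff_add_eq']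
  congr 2
  ext X; simp

variable [CharZero K]

theorem map_topIdempotent (f : RBurnside G K →ₗ[K] K) (c : Subgroup G → ℚ)
    (hc : ∀ X, f ((GSet.quotient X).toRBurnside K) = (c X : K)) :
    f (topIdempotent G K) = ((∑ X : Subgroup G, idempotentCoeff X * c X : ℚ) : K) := by
  simp only [topIdempotent, map_sum, map_smul, hc, smul_eq_mul, Rat.cast_sum, Rat.cast_mul]

open Classical in
theorem mark_topIdempotent (L : Subgroup G) :
    mark K L (topIdempotent G K) = if L = ⊤ then 1 else 0 := by
  rw [map_topIdempotent K (mark K L) (fun X => Nat.card (MulAction.fixedPoints L (G ⧸ X))),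
    sum_idempotentCoeff_mul_card_fixedPoints]
  · split_ifs <;> simp
  · intro X
    rw [mark_toRBurnside, Rat.cast_natCast]
    rfl

variable (G) in
theorem mark_top_topIdempotent : mark K (⊤ : Subgroup G) (topIdempotent G K) = 1 := by
  classical rw [mark_topIdempotent, if_pos rfl]

theorem mark_pullback_subtype_topIdempotent {X : Subgroup G} (hX : X ≠ ⊤) (L : Subgroup X) :
    mark K L ((Biset.pullback X.subtype).burnsideMap K (topIdempotent G K)) = 0 := by
  classical rw [mark_burnsideMap_pullback, mark_topIdempotent, if_neg (map_subtype_ne_top hX L)]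

theorem topIdempotent_mul_of_pullback_eq_zero
    (hres : ∀ X : Subgroup G, X ≠ ⊤ →
      (Biset.pullback X.subtype).burnsideMap K (topIdempotent G K) = 0)
    (x : RBurnside G K) : topIdempotent G K * x = mark K ⊤ x • topIdempotent G K := by
  have quotient_case (X : Subgroup G) : topIdempotent G K * (GSet.quotient X).toRBurnside K =
      mark K ⊤ ((GSet.quotient X).toRBurnside K) • topIdempotent G K := by
    by_cases hX : X = ⊤
    · rw [hX, GSet.toRBurnside_quotient_top, mark_one, one_smul, mul_one]
    · have hmul : topIdempotent G K * (GSet.quotient X).toRBurnside K = 0 := by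
        rw [mul_comm, ← burnsideMap_pushforward_pullback, hres X hX, map_zero]
      have hmark := mark_mul K ⊤ (topIdempotent G K) ((GSet.quotient X).toRBurnside K)
      rw [hmul, map_zero, mark_top_topIdempotent, one_mul] at hmark
      rw [hmul, ← hmark, zero_smul]
  suffices LinearMap.mulLeft K (topIdempotent G K) = (mark K ⊤).smulRight (topIdempotent G K) from
    LinearMap.congr_fun this x
  refine RBurnside.linearMap_ext fun U => ?_
  rw [GSet.toRBurnside]
  induction U.cls using GSetClass.orbit_induction with
  | zero => simp only [map_zero, TensorProduct.tmul_zero]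
  | add a b ha hb => simp only [map_add, TensorProduct.tmul_add, ha, hb]
  | quotient X => exact quotient_case X

theorem eq_zero_of_mark_eq_zero {x : RBurnside G K} (hx : ∀ L, mark K L x = 0) : x = 0 := by
  classical
  induction hn : Nat.card G using Nat.strong_induction_on generalizing G with
  | h n ih =>
  subst hn
  have pullback_eq_zero {X : Subgroup G} (hX : X ≠ ⊤) {y : RBurnside G K}
      (hy : ∀ L, mark K L ((Biset.pullback X.subtype).burnsideMap K y) = 0) :
      (Biset.pullback X.subtype).burnsideMap K y = 0 :=
    ih _ (card_lt_card_of_ne_top hX) hy rfl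
  rw [eq_topIdempotent_mul_sub_sum K x, topIdempotent_mul_of_pullback_eq_zero K fun X hX =>
    pullback_eq_zero hX (mark_pullback_subtype_topIdempotent K hX), hx, zero_smul, zero_sub,
    neg_eq_zero]
  refine Finset.sum_eq_zero fun X hX => ?_
  rw [pullback_eq_zero (Finset.mem_filter.1 hX).2 fun L => by rw [mark_burnsideMap_pullback, hx],
    map_zero, smul_zero]

theorem burnsideMap_pullback_subtype_topIdempotent {X : Subgroup G} (hX : X ≠ ⊤) :
    (Biset.pullback X.subtype).burnsideMap K (topIdempotent G K) = 0 :=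
  eq_zero_of_mark_eq_zero K (mark_pullback_subtype_topIdempotent K hX)

theorem topIdempotent_mul (x : RBurnside G K) :
    topIdempotent G K * x = mark K ⊤ x • topIdempotent G K :=
  topIdempotent_mul_of_pullback_eq_zero K (fun _ => burnsideMap_pullback_subtype_topIdempotent K) x

theorem burnsideIdempotent_top :
    burnsideIdempotent K (⊤ : Subgroup G) = topIdempotent G K := by
  have hprim : IsPrimitiveIdempotent (topIdempotent G K) :=
    isPrimitiveIdempotent_of_mul_eq_smul (markAlgHom K ⊤) (mark_top_topIdempotent G K)
      (topIdempotent_mul K)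
  obtain ⟨hprim', hmark⟩ :
      IsPrimitiveIdempotent (burnsideIdempotent K (⊤ : Subgroup G)) ∧
        mark K ⊤ (burnsideIdempotent K (⊤ : Subgroup G)) = 1 :=
    Classical.epsilon_spec
      (p := fun e : RBurnside G K => IsPrimitiveIdempotent e ∧ mark K ⊤ e = 1)
      ⟨_, hprim, mark_top_topIdempotent G K⟩
  refine (hprim'.eq_of_mul_eq hprim.1 hprim.2.1 ?_).symm
  rw [topIdempotent_mul, hmark, one_smul]

end TopIdempotent

section Deflation

variable {G H : Type u} [Group G] [Group H]

/-- The stabilizer of a point under a right action, as a subgroup of `H` rather than `Hᵐᵒᵖ`. -/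
def rightStabilizer {X : Type*} [MulAction Hᵐᵒᵖ X] (x : X) : Subgroup H :=
  (MulAction.stabilizer Hᵐᵒᵖ x).unop

theorem card_rightStabilizer {X : Type*} [MulAction Hᵐᵒᵖ X] (x : X) :
    Nat.card (rightStabilizer x : Subgroup H) = Nat.card (MulAction.stabilizer Hᵐᵒᵖ x) :=
  Nat.card_congr (rightStabilizer x).equivOp

theorem rightStabilizer_normal_of_isPretransitive {X : Type*} [MulAction G X] [MulAction Hᵐᵒᵖ X]
    [SMulCommClass G Hᵐᵒᵖ X] [MulAction.IsPretransitive G X] (x : X) :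
    (rightStabilizer x : Subgroup H).Normal :=
  (stabilizer_normal_of_isPretransitive (A := G) x).unop

theorem Tens.mk_eq_mk_iff {X U : Type*} [MulAction Hᵐᵒᵖ X] [MulAction H U] (x : X) (u u' : U) :
    Tens.mk H x u = Tens.mk H x u' ↔ ∃ n ∈ (rightStabilizer x : Subgroup H), u' = n • u := by
  constructor
  · intro h
    obtain ⟨n, hx, hu⟩ := Tens.exact h
    exact ⟨n, hx.symm, hu⟩
  · rintro ⟨n, hn, rfl⟩
    have hn' : op n • x = x := hn
    rw [← Tens.mk_smul, hn']

theorem Tens.exists_eq_mk {X U : Type*} [MulAction Hᵐᵒᵖ X] [MulAction H U]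
    [MulAction.IsPretransitive Hᵐᵒᵖ X] (x : X) (t : Tens H X U) : ∃ u, t = Tens.mk H x u := by
  induction t using Tens.ind with | h y u =>
  obtain ⟨h, rfl⟩ := MulAction.exists_smul_eq Hᵐᵒᵖ x y
  exact ⟨h.unop • u, Tens.mk_smul h.unop x u⟩

theorem Tens.isPretransitive {X U : Type*} [MulAction G X] [MulAction Hᵐᵒᵖ X]
    [SMulCommClass G Hᵐᵒᵖ X] [MulAction H U] [MulAction.IsPretransitive G X]
    [MulAction.IsPretransitive H U] : MulAction.IsPretransitive G (Tens H X U) := by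
  refine ⟨Tens.ind fun x u => Tens.ind fun x' u' => ?_⟩
  obtain ⟨h, rfl⟩ := MulAction.exists_smul_eq H u u'
  obtain ⟨g, hg⟩ := MulAction.exists_smul_eq G x (op h • x')
  exact ⟨g, by rw [Tens.left_smul, hg, Tens.mk_smul]⟩

theorem Tens.subsingleton_quotient_iff {X : Type*} [MulAction Hᵐᵒᵖ X]
    [MulAction.IsPretransitive Hᵐᵒᵖ X] (x : X) [hx : (rightStabilizer x : Subgroup H).Normal]
    (Y : Subgroup H) :
    Subsingleton (Tens H X (H ⧸ Y)) ↔ Y ⊔ rightStabilizer x = ⊤ := by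
  have mk_one_eq_iff (b : H) :
      Tens.mk H x ((1 : H) : H ⧸ Y) = Tens.mk H x (b : H ⧸ Y) ↔ b ∈ rightStabilizer x ⊔ Y := by
    rw [Tens.mk_eq_mk_iff, ← SetLike.mem_coe, Subgroup.normal_mul, Set.mem_mul]
    refine exists_congr fun n => and_congr_right fun _ => ?_
    rw [eq_comm, MulAction.Quotient.smul_coe, smul_eq_mul, mul_one, QuotientGroup.eq]
    exact ⟨fun h => ⟨_, h, mul_inv_cancel_left n b⟩, by rintro ⟨y, hy, rfl⟩; simpa using hy⟩
  rw [sup_comm, ← top_le_iff]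
  refine ⟨fun h b _ => (mk_one_eq_iff b).1 (h.elim _ _), fun h => ⟨fun s t => ?_⟩⟩
  have eq_mk_one (t : Tens H X (H ⧸ Y)) : Tens.mk H x ((1 : H) : H ⧸ Y) = t := by
    obtain ⟨q, rfl⟩ := Tens.exists_eq_mk x t
    obtain ⟨b, rfl⟩ := QuotientGroup.mk_surjective q
    exact (mk_one_eq_iff b).2 (h trivial)
  rw [← eq_mk_one s, eq_mk_one t]

theorem mark_top_burnsideMap_topIdempotent [Finite H] (K : Type v) [Field K] [CharZero K]
    (X : Biset G H) [MulAction.IsPretransitive G X] [MulAction.IsPretransitive Hᵐᵒᵖ X] (x : X) :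
    mark K ⊤ (X.burnsideMap K (topIdempotent H K)) =
      (deflationNumber H (rightStabilizer x) : K) := by
  classical
  have := rightStabilizer_normal_of_isPretransitive (G := G) (H := H) x
  rw [← LinearMap.comp_apply, deflationNumber_eq_sum_idempotentCoeff]
  refine map_topIdempotent K _ _ fun Y => ?_
  have : MulAction.IsPretransitive G (X.act (GSet.quotient Y)) :=
    have : MulAction.IsPretransitive H (GSet.quotient Y) :=
      MulAction.isPretransitive_quotient H Y
    Tens.isPretransitive (X := X) (U := GSet.quotient Y)
  have : Nonempty (X.act (GSet.quotient Y)) := ⟨Tens.mk H x ((1 : H) : H ⧸ Y)⟩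
  have subsingleton_iff : Subsingleton (X.act (GSet.quotient Y)) ↔ Y ⊔ rightStabilizer x = ⊤ :=
    Tens.subsingleton_quotient_iff x Y
  rw [LinearMap.comp_apply, Biset.burnsideMap_toRBurnside, mark_toRBurnside,
    card_fixedPoints_top_of_isPretransitive]
  simp only [subsingleton_iff]
  split_ifs <;> simp

theorem mark_top_burnsideMap_pushforward_topIdempotent [Finite G] [Finite H] (K : Type v) [Field K]
    [CharZero K] {f : G →* H} (hf : Function.Surjective f) :
    mark K ⊤ ((Biset.pushforward f).burnsideMap K (topIdempotent G K)) =
      (deflationNumber G f.ker : K) := by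
  have : MulAction.IsPretransitive H (Biset.pushforward f) :=
    inferInstanceAs (MulAction.IsPretransitive H H)
  have : MulAction.IsPretransitive Gᵐᵒᵖ (Biset.pushforward f) := by
    refine ⟨fun (x y : H) => ?_⟩
    obtain ⟨g, hg⟩ := hf (x⁻¹ * y)
    exact ⟨op g, show x * f g = y by rw [hg, mul_inv_cancel_left]⟩
  have stab_eq : rightStabilizer (show Biset.pushforward f from (1 : H)) = f.ker :=
    congrArg Subgroup.unop (Biset.stabilizer_pushforward _)
  rw [mark_top_burnsideMap_topIdempotent K _ (show Biset.pushforward f from (1 : H)), stab_eq]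

end Deflation

section Dominance

section OrbitBiset

variable {G H : Type u} [Group G] [Group H] {X : Biset G H} (x : X)

/-- The projection to `H` of the stabilizer of `x` in `G × Hᵐᵒᵖ`: the elements of `H` whose action
on `x` agrees with that of some element of `G`. -/
def rightProjection : Subgroup H where
  carrier := {h | ∃ g : G, g • x = op h • x}
  one_mem' := ⟨1, by simp⟩
  mul_mem' := by
    rintro a b ⟨g, hg⟩ ⟨k, hk⟩
    exact ⟨g * k, by rw [mul_smul, hk, smul_comm, hg, smul_smul, op_mul]⟩
  inv_mem' := by
    rintro a ⟨g, hg⟩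
    refine ⟨g⁻¹, ?_⟩
    rw [inv_smul_eq_iff, smul_comm, hg, smul_smul, ← op_mul, mul_inv_cancel, op_one, one_smul]

theorem isPretransitive_left_of_rightProjection_eq_top [MulAction.IsPretransitive Hᵐᵒᵖ X]
    (hx : rightProjection x = ⊤) : MulAction.IsPretransitive G X := by
  refine (MulAction.isPretransitive_iff_base x).2 fun y => ?_
  obtain ⟨h, rfl⟩ := MulAction.exists_smul_eq Hᵐᵒᵖ x y
  exact show h.unop ∈ rightProjection x from hx ▸ Subgroup.mem_top h.unop

/-- The left orbit of `x`, as a biset for `G` and `rightProjection x`. -/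
def orbitBiset : Biset G (rightProjection x) where
  carrier := MulAction.orbit G x
  right :=
    { smul := fun q y => ⟨op (q.unop : H) • y.1, by
        obtain ⟨_, g, rfl⟩ := y
        obtain ⟨k, hk⟩ := q.unop.2
        exact ⟨g * k, show (g * k) • x = op (q.unop : H) • g • x by rw [mul_smul, hk, smul_comm]⟩⟩
      one_smul := fun y => Subtype.ext (one_smul Hᵐᵒᵖ y.1)
      mul_smul := fun a b y => Subtype.ext (mul_smul (op (a.unop : H)) (op (b.unop : H)) y.1) }
  comm := @SMulCommClass.mk _ _ _ (_) (_) fun g q y =>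
    Subtype.ext (smul_comm g (op (q.unop : H)) y.1)

variable [MulAction.IsPretransitive Hᵐᵒᵖ X]

instance : MulAction.IsPretransitive (rightProjection x)ᵐᵒᵖ (orbitBiset x) := by
  let x₀ : orbitBiset x := ⟨x, MulAction.mem_orbit_self x⟩
  refine (MulAction.isPretransitive_iff_base x₀).2 ?_
  rintro ⟨y, g, hg⟩
  obtain ⟨h, rfl⟩ := MulAction.exists_smul_eq Hᵐᵒᵖ x y
  exact ⟨op ⟨h.unop, g, hg⟩, rfl⟩

/-- For a right transitive biset `X`, the bijection `[y, u] ↦ [y, u]` from the tensor product of the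
left orbit of `x` with the restriction of `U` to `X ×_H U`. -/
def orbitBisetEquiv (U : GSet H) :
    (orbitBiset x).act (U.comap (rightProjection x).subtype) ≃ X.act U :=
  Equiv.ofBijective
    (Tens.lift (fun y (u : U) => Tens.mk H y.1 u)
      fun q y (u : U) => Tens.mk_smul (q : H) y.1 u) <| by
    let x₀ : orbitBiset x := ⟨x, MulAction.mem_orbit_self x⟩
    constructor
    · intro s t hst
      obtain ⟨u, rfl⟩ := Tens.exists_eq_mk x₀ s
      obtain ⟨v, rfl⟩ := Tens.exists_eq_mk x₀ t
      obtain ⟨n, hn, hv⟩ := (Tens.mk_eq_mk_iff x (show U from u) v).1 hst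
      have hn' : n ∈ rightProjection x := ⟨1, (one_smul G x).trans hn.symm⟩
      exact (Tens.mk_eq_mk_iff x₀ u v).2 ⟨⟨n, hn'⟩, Subtype.ext hn, hv⟩
    · intro t
      obtain ⟨u, rfl⟩ := Tens.exists_eq_mk x t
      exact ⟨Tens.mk _ x₀ u, rfl⟩

theorem burnsideMap_orbitBiset_pullback [Finite H] (R : Type v) [CommRing R] (a : RBurnside H R) :
    (orbitBiset x).burnsideMap R
      ((Biset.pullback (rightProjection x).subtype).burnsideMap R a) = X.burnsideMap R a := by
  suffices (orbitBiset x).burnsideMap R ∘ₗ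
        (Biset.pullback (rightProjection x).subtype).burnsideMap R = X.burnsideMap R from
    LinearMap.congr_fun this a
  refine RBurnside.linearMap_ext fun U => ?_
  rw [LinearMap.comp_apply, Biset.burnsideMap_pullback_toRBurnside, Biset.burnsideMap_toRBurnside,
    Biset.burnsideMap_toRBurnside]
  exact GSet.toRBurnside_congr R (orbitBisetEquiv x U) fun g => Tens.ind fun _ _ => rfl

theorem rightProjection_eq_top_of_burnsideMap_ne_zero [Finite H] {K : Type v} [Field K] [CharZero K]
    (h : X.burnsideMap K (topIdempotent H K) ≠ 0) : rightProjection x = ⊤ := by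
  contrapose! h
  rw [← burnsideMap_orbitBiset_pullback x, burnsideMap_pullback_subtype_topIdempotent K h, map_zero]

end OrbitBiset

theorem exists_smul_eq_of_mark_burnsideMap_ne_zero {G H : Type u} [Group G] [Group H]
    {R : Type v} [CommRing R] {X : Biset G H} {a : RBurnside H R}
    (h : mark R ⊤ (X.burnsideMap R a) ≠ 0) : ∃ x : X, ∀ g : G, ∃ h : H, g • x = op h • x := by
  contrapose! h
  suffices mark R ⊤ ∘ₗ X.burnsideMap R = 0 from LinearMap.congr_fun this a
  refine RBurnside.linearMap_ext fun U => ?_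
  have no_fixed_point : IsEmpty (MulAction.fixedPoints (⊤ : Subgroup G) (X.act U)) := by
    refine ⟨fun ⟨t, ht⟩ => ?_⟩
    induction t using Tens.ind with | h x u =>
    obtain ⟨g, hg⟩ := h x
    obtain ⟨k, hk, -⟩ := Tens.exact (ht ⟨g, trivial⟩)
    exact hg k hk
  rw [LinearMap.comp_apply, Biset.burnsideMap_toRBurnside, mark_toRBurnside, Nat.card_of_isEmpty,
    Nat.cast_zero, LinearMap.zero_apply]

theorem Biset.IsPretransitive.isPretransitive_right {G H : Type u} [Group G] [Group H]
    {X : Biset G H} (hX : X.IsPretransitive) {x : X} (hx : ∀ g : G, ∃ h : H, g • x = op h • x) :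
    MulAction.IsPretransitive Hᵐᵒᵖ X := by
  refine (MulAction.isPretransitive_iff_base x).2 fun y => ?_
  obtain ⟨g, h, rfl⟩ := hX x y
  obtain ⟨k, hk⟩ := hx g
  exact ⟨op h * op k, by rw [mul_smul, ← hk, smul_comm g]⟩

/-- The homomorphism sends `g` to the unique `h` with `g • x = x • h`. -/
theorem exists_surjective_ker_eq_stabilizer {G H X : Type*} [Group G] [Group H] [MulAction G X]
    [MulAction Hᵐᵒᵖ X] [SMulCommClass G Hᵐᵒᵖ X] [MulAction.IsPretransitive G X]
    [MulAction.IsPretransitive Hᵐᵒᵖ X] {x : X} (hx : (rightStabilizer x : Subgroup H) = ⊥) :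
    ∃ f : G →* H, Function.Surjective f ∧ f.ker = MulAction.stabilizer G x := by
  have eq_of_smul_eq (a b : H) (h : op a • x = op b • x) : a = b := by
    have : a * b⁻¹ ∈ (rightStabilizer x : Subgroup H) :=
      show op (a * b⁻¹) • x = x by
        rw [op_mul, mul_smul, h, smul_smul, ← op_mul, mul_inv_cancel, op_one, one_smul]
    rw [hx, Subgroup.mem_bot] at this
    exact mul_inv_eq_one.1 this
  choose φ hφ using fun g : G => MulAction.exists_smul_eq Hᵐᵒᵖ x (g • x)
  let f : G →* H := MonoidHom.mk' (fun g => (φ g).unop) fun a b => eq_of_smul_eq _ _ <| by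
    rw [op_unop, hφ, mul_smul, ← hφ b, smul_comm, ← hφ a, smul_smul, op_mul, op_unop, op_unop]
  have op_smul (g : G) : op (f g) • x = g • x := hφ g
  refine ⟨f, fun h => ?_, ?_⟩
  · obtain ⟨g, hg⟩ := MulAction.exists_smul_eq G x (op h • x)
    exact ⟨g, eq_of_smul_eq _ _ ((op_smul g).trans hg)⟩
  · ext g
    rw [MonoidHom.mem_ker, MulAction.mem_stabilizer_iff, ← op_smul]
    exact ⟨fun h => by rw [h, op_one, one_smul],
      fun h => eq_of_smul_eq _ _ (by rw [h, op_one, one_smul])⟩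

variable {p : ℕ} {G H : FiniteGrp.{u}}

theorem dominates_of_surjective {f : G →* H} (hf : Function.Surjective f)
    (hp : (Nat.card f.ker).Coprime p) : Dominates p G H :=
  ⟨f.ker, inferInstance, hp, ⟨QuotientGroup.quotientKerEquivOfSurjective f hf⟩⟩

variable {K : Type v} [Field K] [CharZero K]

theorem dominates_of_mark_burnsideMap_ne_zero (hH : IsBDeltaGroup p H) {X : Biset G H}
    (hX : X.IsBifree p) (htr : X.IsPretransitive)
    (h : mark K ⊤ (X.burnsideMap K (topIdempotent H K)) ≠ 0) : Dominates p G H := by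
  obtain ⟨x, hx⟩ := exists_smul_eq_of_mark_burnsideMap_ne_zero h
  have right_transitive : MulAction.IsPretransitive Hᵐᵒᵖ X := htr.isPretransitive_right hx
  have left_transitive : MulAction.IsPretransitive G X :=
    isPretransitive_left_of_rightProjection_eq_top x
      (rightProjection_eq_top_of_burnsideMap_ne_zero x fun h0 => h (by rw [h0, map_zero]))
  have right_free : (rightStabilizer x : Subgroup H) = ⊥ := by
    contrapose! h
    rw [mark_top_burnsideMap_topIdempotent K X x,
      hH _ (rightStabilizer_normal_of_isPretransitive (G := G) x) h
        (card_rightStabilizer (H := H) x ▸ (hX x).2), Rat.cast_zero]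
  obtain ⟨f, hf, hker⟩ := exists_surjective_ker_eq_stabilizer (G := G) right_free
  exact dominates_of_surjective hf (hker ▸ (hX x).1)

theorem mark_scalarLift₂_actHom_topIdempotent (hH : IsBDeltaGroup p H) (hGH : ¬Dominates p G H)
    (f : K ⊗[ℤ] BDelta G H p) : mark K ⊤ (scalarLift₂ K actHom f (topIdempotent H K)) = 0 := by
  induction f using scalar_ind with
  | hadd x y hx hy => rw [map_add, LinearMap.add_apply, map_add, hx, hy, add_zero]
  | h r c =>
    induction c using BifreeClass.orbit_induction with
    | pretransitive X hX htr =>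
      have mark_eq_zero : mark K ⊤ (X.burnsideMap K (topIdempotent H K)) = 0 :=
        not_imp_comm.1 (dominates_of_mark_burnsideMap_ne_zero hH hX htr) hGH
      rw [scalarLift₂_actHom_tmul_cls, LinearMap.smul_apply, map_smul, mark_eq_zero, smul_zero]
    | add a b ha hb =>
      have cl_add : cl (a + b) = cl a + cl b := map_add _ a b
      rw [cl_add, TensorProduct.tmul_add, map_add, LinearMap.add_apply, map_add, ha, hb, add_zero]

end Dominance

section Subfunctors

section SubmoduleFunctor

variable {R : Type u} [CommRing R] {C : Type v} [Category* C] {F : C ⥤ ModuleCat.{w} R}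

theorem SubmoduleFunctor.generated_le_iff {X : C} {x : F.obj X} {T : SubmoduleFunctor F} :
    SubmoduleFunctor.generated x ≤ T ↔ x ∈ T.obj X := by
  constructor
  · intro h
    exact h X (Submodule.subset_span ⟨𝟙 X, by simp⟩)
  · intro h Y
    refine Submodule.span_le.2 ?_
    rintro _ ⟨f, rfl⟩
    exact T.map_mem f x h

theorem SubmoduleFunctor.le_sum {ι : Type*} (T : ι → SubmoduleFunctor F) (i : ι) :
    T i ≤ SubmoduleFunctor.sum T :=
  fun X => le_iSup (fun i => (T i).obj X) i

end SubmoduleFunctor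

variable {p : ℕ} [Fact p.Prime] {K : Type v} [Field K]

/-- The evaluation at `G` of a subfunctor of `KB`, as a submodule of `KB(G)`. -/
def SubmoduleFunctor.eval (F : SubmoduleFunctor (burnsideFunctor.{u, v} p K)) (G : FiniteGrp.{u}) :
    Submodule K (RBurnside G K) :=
  F.obj ⟨G⟩

theorem SubmoduleFunctor.burnsideMap_mem (F : SubmoduleFunctor (burnsideFunctor.{u, v} p K))
    {G H : FiniteGrp.{u}} {X : Biset H G} (hX : X.IsBifree p) {x : RBurnside G K}
    (hx : x ∈ F.eval G) : X.burnsideMap K x ∈ F.eval H := by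
  rw [← one_smul K (X.burnsideMap K), ← scalarLift₂_actHom_tmul_cls hX]
  exact F.map_mem (X := ⟨G⟩) (Y := ⟨H⟩) (1 ⊗ₜ cl (X.cls hX)) x hx

theorem coprime_card_ker_subtype {G : Type*} [Group G] (X : Subgroup G) (p : ℕ) :
    (Nat.card X.subtype.ker).Coprime p := by
  rw [X.ker_subtype, Subgroup.card_bot]
  exact Nat.coprime_one_left p

variable {F F' : SubmoduleFunctor (burnsideFunctor.{u, v} p K)} {G H : FiniteGrp.{u}}

theorem pullback_subtype_mem {x : RBurnside G K} (hx : x ∈ F.eval G) (X : Subgroup G) :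
    (Biset.pullback X.subtype).burnsideMap K x ∈ F.eval (FiniteGrp.of X) :=
  F.burnsideMap_mem (H := FiniteGrp.of X)
    (Biset.isBifree_pullback (coprime_card_ker_subtype X p)) hx

theorem pushforward_subtype_mem {X : Subgroup G} {x : RBurnside X K}
    (hx : x ∈ F.eval (FiniteGrp.of X)) :
    (Biset.pushforward X.subtype).burnsideMap K x ∈ F.eval G :=
  F.burnsideMap_mem (G := FiniteGrp.of X)
    (Biset.isBifree_pushforward (coprime_card_ker_subtype X p)) hx

variable [CharZero K]

theorem topIdempotent_mem_of_mark_ne_zero {x : RBurnside G K} (hx : x ∈ F.eval G)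
    (h : mark K ⊤ x ≠ 0) : topIdempotent G K ∈ F.eval G := by
  rw [← Submodule.smul_mem_iff _ h, ← topIdempotent_mul, topIdempotent_mul_eq_sum]
  exact Submodule.sum_mem _ fun X _ =>
    Submodule.smul_mem _ _ (pushforward_subtype_mem (pullback_subtype_mem hx X))

theorem eDelta_le_iff : eDelta p K G ≤ F ↔ topIdempotent G K ∈ F.eval G := by
  rw [← burnsideIdempotent_top]
  exact SubmoduleFunctor.generated_le_iff

variable (p K G) in
theorem topIdempotent_mem_eDelta : topIdempotent G K ∈ (eDelta p K G).eval G :=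
  eDelta_le_iff.1 le_rfl

theorem le_of_forall_eDelta_le (h : ∀ G : FiniteGrp.{u}, eDelta p K G ≤ F → eDelta p K G ≤ F') :
    F ≤ F' := by
  suffices ∀ (G : FiniteGrp.{u}) (x : RBurnside G K), x ∈ F.eval G → x ∈ F'.eval G from
    fun G x hx => this G.grp x hx
  intro G x hx
  induction hn : Nat.card G using Nat.strong_induction_on generalizing G with
  | h n ih =>
  classical
  rw [eq_topIdempotent_mul_sub_sum K x]
  refine Submodule.sub_mem _ ?_ (Submodule.sum_mem _ fun X hX => Submodule.smul_mem _ _ ?_)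
  · rw [topIdempotent_mul]
    by_cases hm : mark K ⊤ x = 0
    · rw [hm, zero_smul]
      exact Submodule.zero_mem _
    · exact Submodule.smul_mem _ _
        (eDelta_le_iff.1 (h G (eDelta_le_iff.2 (topIdempotent_mem_of_mark_ne_zero hx hm))))
  · have card_lt : Nat.card X < n := hn ▸ card_lt_card_of_ne_top (Finset.mem_filter.1 hX).2
    exact pushforward_subtype_mem
      (ih _ card_lt (FiniteGrp.of X) _ (pullback_subtype_mem hx X) rfl)

variable (K) in
theorem eDelta_le_of_dominates (h : Dominates p G H) : eDelta p K G ≤ eDelta p K H := by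
  obtain ⟨N, hN, hp, ⟨e⟩⟩ := h
  let f : G →* H := (e : G ⧸ N →* H).comp (QuotientGroup.mk' N)
  have hf : Function.Surjective f := e.surjective.comp (QuotientGroup.mk'_surjective N)
  have ker_eq : f.ker = N := by rw [MonoidHom.ker_mulEquiv_comp, QuotientGroup.ker_mk']
  have mark_inflation :
      mark K ⊤ ((Biset.pullback f).burnsideMap K (topIdempotent H K)) = 1 := by
    rw [mark_burnsideMap_pullback, Subgroup.map_top_of_surjective f hf, mark_top_topIdempotent]
  exact eDelta_le_iff.2 (topIdempotent_mem_of_mark_ne_zero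
    ((eDelta p K H).burnsideMap_mem (Biset.isBifree_pullback (ker_eq ▸ hp))
      (topIdempotent_mem_eDelta p K H))
    (mark_inflation ▸ one_ne_zero))

variable (K) in
theorem eDelta_le_of_mulEquiv (e : G ≃* H) : eDelta p K G ≤ eDelta p K H :=
  eDelta_le_of_dominates K ⟨⊥, inferInstance, by simp, ⟨QuotientGroup.quotientBot.trans e⟩⟩

variable (K) in
theorem eDelta_eq_of_mulEquiv (e : G ≃* H) : eDelta p K G = eDelta p K H :=
  le_antisymm (eDelta_le_of_mulEquiv K e) (eDelta_le_of_mulEquiv K e.symm)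

variable (K) in
theorem eDelta_eq_quotient {N : Subgroup G} [N.Normal] (hp : (Nat.card N).Coprime p)
    (hN : deflationNumber G N ≠ 0) : eDelta p K G = eDelta p K (FiniteGrp.of (G ⧸ N)) := by
  refine le_antisymm (eDelta_le_of_dominates K ⟨N, inferInstance, hp, ⟨MulEquiv.refl _⟩⟩) ?_
  have mark_deflation := mark_top_burnsideMap_pushforward_topIdempotent K
    (QuotientGroup.mk'_surjective N)
  rw [QuotientGroup.ker_mk'] at mark_deflation
  exact eDelta_le_iff.2 (topIdempotent_mem_of_mark_ne_zero (G := FiniteGrp.of (G ⧸ N))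
    ((eDelta p K G).burnsideMap_mem
      (Biset.isBifree_pushforward ((QuotientGroup.ker_mk' N).symm ▸ hp))
      (topIdempotent_mem_eDelta p K G))
    (mark_deflation ▸ Rat.cast_ne_zero.2 hN))

variable (p K G) in
theorem exists_isBDeltaGroup_eDelta_eq :
    ∃ H : FiniteGrp.{u}, IsBDeltaGroup p H ∧ eDelta p K G = eDelta p K H := by
  induction hn : Nat.card G using Nat.strong_induction_on generalizing G with
  | h n ih =>
  by_cases hG : IsBDeltaGroup p G
  · exact ⟨G, hG, rfl⟩
  · simp only [IsBDeltaGroup, not_forall] at hG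
    obtain ⟨N, hN, hne, hp, hm⟩ := hG
    have card_lt : Nat.card (G ⧸ N) < n := by
      rw [← hn, Subgroup.card_eq_card_quotient_mul_card_subgroup N]
      exact lt_mul_of_one_lt_right Nat.card_pos ((Subgroup.one_lt_card_iff_ne_bot N).2 hne)
    obtain ⟨H, hH, hH'⟩ := ih _ card_lt (FiniteGrp.of (G ⧸ N)) rfl
    exact ⟨H, hH, (eDelta_eq_quotient K hp hm).trans hH'⟩

theorem eval_eDelta_le_ker_mark (hH : IsBDeltaGroup p H) (hGH : ¬Dominates p G H) :
    (eDelta p K H).eval G ≤ LinearMap.ker (mark K (⊤ : Subgroup G)) := by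
  refine Submodule.span_le.2 ?_
  rintro _ ⟨f, rfl⟩
  rw [burnsideIdempotent_top]
  exact mark_scalarLift₂_actHom_topIdempotent hH hGH f

theorem exists_dominates_of_eDelta_le_sum {A : Set FiniteGrp.{u}}
    (hA : ∀ H ∈ A, IsBDeltaGroup p H)
    (h : eDelta p K G ≤ SubmoduleFunctor.sum fun H : A => eDelta p K H.1) :
    ∃ H ∈ A, Dominates p G H := by
  by_contra! hGA
  have eval_le : (⨆ H : A, (eDelta p K H.1).eval G) ≤ LinearMap.ker (mark K (⊤ : Subgroup G)) :=
    iSup_le fun H => eval_eDelta_le_ker_mark (hA H H.2) (hGA H H.2)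
  have mark_eq_zero : mark K ⊤ (topIdempotent G K) = 0 := eval_le (eDelta_le_iff.1 h)
  rw [mark_top_topIdempotent] at mark_eq_zero
  exact one_ne_zero mark_eq_zero

/-- The closed subset of `S` attached to the subfunctor `F` of `KB`: the groups `H ∈ S` with
`e^Δ_H ⊆ F`. -/
def closedSubsetOf (S : Set FiniteGrp.{u}) (F : SubmoduleFunctor (burnsideFunctor.{u, v} p K)) :
    ClosedSubset p S :=
  ⟨{H | H ∈ S ∧ eDelta p K H ≤ F}, fun _ h => h.1, fun _ hH _ hG hGH =>
    ⟨hG, (eDelta_le_of_dominates K hGH).trans hH.2⟩⟩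

variable {S : Set FiniteGrp.{u}}

theorem closedSubsetOf_le_iff
    (hS : ∀ G : FiniteGrp.{u}, IsBDeltaGroup p G → ∃ H ∈ S, Nonempty (G ≃* H)) :
    closedSubsetOf S F ≤ closedSubsetOf S F' ↔ F ≤ F' := by
  refine ⟨fun h => le_of_forall_eDelta_le fun G hG => ?_, fun h H hH => ⟨hH.1, hH.2.trans h⟩⟩
  obtain ⟨H, hH, hGH⟩ := exists_isBDeltaGroup_eDelta_eq p K G
  obtain ⟨H', hH', ⟨e⟩⟩ := hS H hH
  rw [hGH, eDelta_eq_of_mulEquiv K e] at hG ⊢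
  exact (h ⟨hH', hG⟩).2

theorem closedSubsetOf_sum (hS : ∀ G ∈ S, IsBDeltaGroup p G) (A : ClosedSubset p S) :
    closedSubsetOf S (SubmoduleFunctor.sum fun H : (A : Set FiniteGrp.{u}) => eDelta p K H.1) =
      A := by
  refine Subtype.ext (Set.ext fun G => ⟨fun hG => ?_, fun hG => ⟨A.2.1 hG, ?_⟩⟩)
  · obtain ⟨H, hH, hGH⟩ := exists_dominates_of_eDelta_le_sum (fun H hH => hS H (A.2.1 hH)) hG.2
    exact A.2.2 H hH G hG.1 hGH
  · exact SubmoduleFunctor.le_sum (fun H : (A : Set FiniteGrp.{u}) => eDelta p K H.1) ⟨G, hG⟩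

end Subfunctors

end PBifree

end

theorem mainTheorem2_general (p : ℕ) [Fact p.Prime] (K : Type v) [Field K] [CharZero K]
    (S : Set FiniteGrp.{u}) (hS : ∀ G ∈ S, PBifree.IsBDeltaGroup p G)
    (hS' : ∀ G : FiniteGrp.{u}, PBifree.IsBDeltaGroup p G → ∃ H ∈ S, Nonempty (G ≃* H)) :
    ∃ Θ : PBifree.SubmoduleFunctor (PBifree.burnsideFunctor.{u, v} p K) ≃o
        PBifree.ClosedSubset p S,
      (∀ F, (Θ F : Set FiniteGrp.{u}) = {H | H ∈ S ∧ PBifree.eDelta p K H ≤ F}) ∧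
      ∀ A : PBifree.ClosedSubset p S,
        Θ.symm A = PBifree.SubmoduleFunctor.sum
          (fun H : (A : Set FiniteGrp.{u}) => PBifree.eDelta p K H) := by
  have injective : Function.Injective (PBifree.closedSubsetOf (p := p) (K := K) S) :=
    (OrderEmbedding.ofMapLEIff _ fun _ _ => PBifree.closedSubsetOf_le_iff hS').injective
  let Θ : PBifree.SubmoduleFunctor (PBifree.burnsideFunctor.{u, v} p K) ≃o
      PBifree.ClosedSubset p S :=
    { toFun := PBifree.closedSubsetOf S
      invFun := fun A => PBifree.SubmoduleFunctor.sum
        fun H : (A : Set FiniteGrp.{u}) => PBifree.eDelta p K H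
      left_inv := fun _ => injective (PBifree.closedSubsetOf_sum hS _)
      right_inv := PBifree.closedSubsetOf_sum hS
      map_rel_iff' := PBifree.closedSubsetOf_le_iff hS' }
  exact ⟨Θ, fun _ => rfl, fun _ => rfl⟩

theorem mainTheorem2 (p : ℕ) [Fact p.Prime] (K : Type v) [Field K] [CharZero K]
    (S : Set FiniteGrp.{u}) (hS : PBifree.IsBDeltaRepresentatives p S) :
    ∃ Θ : PBifree.SubmoduleFunctor (PBifree.burnsideFunctor.{u, v} p K) ≃o
        PBifree.ClosedSubset p S,
      (∀ F, (Θ F : Set FiniteGrp.{u}) = {H | H ∈ S ∧ PBifree.eDelta p K H ≤ F}) ∧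
      ∀ A : PBifree.ClosedSubset p S,
        Θ.symm A = PBifree.SubmoduleFunctor.sum
          (fun H : (A : Set FiniteGrp.{u}) => PBifree.eDelta p K H) :=
  mainTheorem2_general p K S hS.1 fun G hG => (hS.2 G hG).exists
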